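/- **Theorem (uniform convergence of the classical two-level AMG method for jump coefficients).** Let $d\in\{1,2,3\}$, $\sigma\ge 1$ and $\theta\in(0,1)$. There is a constant $K\ge 1$, depending only on $d$, $\sigma$ and $\theta$, such that the following holds for every choice of the data below; in particular $K$ does not depend on the domain, on the mesh and its size, on the subdomains or on $\varepsilon$. *Problem.* Let $\Omega\subset\mathbb R^d$ be a bounded domain (open, connected) with a conforming simplicial mesh $\mathcal T_h$ with nodes $x_1,\dots,x_n$ ($\overline\Omega=\bigcup_{T\in\mathcal T_h}T$, and $\Omega$ contains the interior of every $T$). Suppose that the mesh is shape regular with constant $\sigma$: for all $T\in\mathcal T_h$, $\underline h_T\le h_T\le\overline h_T\le\sigma\,\underline h_T$, where $\overline h_T=\operatorname{diam}T$, $h_T=|T|^{1/d}$, and $\underline h_T=2\sup\{r>0: B(x,r)\subset T\text{ for some }x\in T\}$. Let $\Omega_1,\Omega_2\subset\Omega$ be disjoint sets such that the interior of every $T$ is contained in $\Omega_1$ or in $\Omega_2$, let $\varepsilon>0$, and let $\alpha=\varepsilon$ on $\Omega_1$, $\alpha=1$ on $\Omega_2$. Let $\phi_1,\dots,\phi_n$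 be the nodal basis of the continuous piecewise linear functions on $\mathcal T_h$ and $A=(a_{ij})$, $a_{ij}=\int_\Omega\alpha\,\nabla\phi_j\cdot\nabla\phi_i\,dx$, the stiffness matrix of $-\nabla\cdot(\alpha\nabla u)=f$ with homogeneous Neumann boundary condition. $A$ is symmetric positive semidefinite; put $\|v\|_A^2=(Av,v)$ and let $D$ be the diagonal of $A$. *Strength of connection and filtering.* Distinct $i,j$ are strongly connected if $$s_c(i,j)=\frac{a_{ij}}{\min\bigl(\min_{k\ne i}a_{ik},\ \min_{k\ne j}a_{jk}\bigr)}>\theta .$$ Let $G$ be the graph of strong connections on $\{1,\dots,n\}$, $N_i$ the set of neighbours of $i$ in $G$, and $A_S=(\tilde a_{ij})$ the filtered matrix, $(A_Su,v)=\sum_{(i,j)\in G}(-a_{ij})(u_i-u_j)(v_i-v_j)$, where the sum is over the edges of $G$. *C/F splitting and coarse space.* Let $\mathcal C$ be any maximal independent set of $G$ and $\mathcal F$ its complement. For $j\in\mathcal C$ let $\Omega_j=\{j\}\cup(\mathcal F\cap s_j)$ with $s_j=N_j\cup\bigcup_{i\in N_j}N_i$ (standard interpolation), $V_j=\mathbb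 R^{\Omega_j}$, let $\chi_j:\mathbb R^n\to V_j$ be the restriction, and define $\Pi_j:V_j\to\mathbb R^n$ by $(\Pi_jv)_i=p_{ij}v_i$ for $i\in\Omega_j$ and $(\Pi_jv)_i=0$ otherwise, where $p_{ij}$ are given weights. The weights are called admissible if $|p_{ij}|\le1$ for $j\in\mathcal C$, $i\in\Omega_j$, and $\sum_{j\in\mathcal C}\Pi_j\chi_j=I$. Let $V_j^c=\operatorname{span}\{\mathbf 1\}\subset V_j$, $V_c=\sum_{j\in\mathcal C}\Pi_jV_j^c=\operatorname{span}\{P_j: j\in\mathcal C\}$ with $P_j=\Pi_j\mathbf 1$, and let $P$ be the matrix with the columns $P_j$. *Two-level method.* Let $R\in\mathbb R^{n\times n}$ be a smoother such that $\bar R=R+R^T-R^TAR$ is symmetric positive definite, and let $c^D$ be a number such that $(\bar R^{-1}v,v)\le c^D(Dv,v)$ for all $v$. Let $B$ be given by $w=PA_c^{\dagger}P^Tg$, $A_c=P^TAP$, $Bg=w+R(g-Aw)$, where $A_c^\dagger$ is the Moore–Penrose pseudo-inverse, and let $E=I-BA$. *Conclusion.* 1. The weights of standard interpolation for $A_S$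 are admissible. These are $p_{ij}=\delta_{ij}$ for $i\in\mathcal C$ and $p_{ij}=\hat a_{ij}/\sum_{l\in\mathcal C}\hat a_{il}$ for $i\in\mathcal F$, $j\in\mathcal C$, with $\hat a_{ij}=\tilde a_{ij}-\sum_{k\in\mathcal F,\,k\ne i}\tilde a_{ik}\tilde a_{kj}/\tilde a_{kk}$ (terms with $\tilde a_{ik}=0$ being zero). 2. For all admissible weights, in particular for those of standard interpolation, and for all such $R$ and $c^D$, one has $c^D\ge1$ and $$\|Ev\|_A^2\le\Bigl(1-\frac1{c^DK}\Bigr)\|v\|_A^2\qquad\text{for all }v\in\mathbb R^n .$$ Thus the two-level method converges uniformly: its rate depends only on $d$, $\sigma$, $\theta$ and the smoother constant $c^D$, and not on the mesh size or on $\varepsilon$. -/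

import Mathlib

open scoped Matrix InnerProductSpace

noncomputable section

namespace JumpAMG

/-! ### Conforming simplicial meshes and shape regularity -/

/-- A conforming simplicial mesh in `ℝ^d` with `n` nodes: every element is (the node set of) a
nondegenerate `d`-simplex, two elements meet exactly in the simplex spanned by their common nodes,
and every node belongs to an element. -/
structure SimplicialMesh (d n : ℕ) where
  node : Fin n → EuclideanSpace ℝ (Fin d)
  elems : Finset (Finset (Fin n))
  card_elem : ∀ T ∈ elems, T.card = d + 1
  affineIndependent : ∀ T ∈ elems, AffineIndependent ℝ (fun i : T => node i)
  conforming : ∀ T ∈ elems, ∀ T' ∈ elems,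
    convexHull ℝ (node '' (T : Set (Fin n))) ∩ convexHull ℝ (node '' (T' : Set (Fin n)))
      = convexHull ℝ (node '' ((T : Set (Fin n)) ∩ (T' : Set (Fin n))))
  node_mem : ∀ i, ∃ T ∈ elems, i ∈ T

namespace SimplicialMesh

variable {d n : ℕ} (M : SimplicialMesh d n)

/-- The closed simplex spanned by a set of nodes. -/
def cell (T : Finset (Fin n)) : Set (EuclideanSpace ℝ (Fin d)) :=
  convexHull ℝ (M.node '' (T : Set (Fin n)))

/-- `M` is a mesh of the domain `Ω` (open and connected). The last clause says that `Ω` contains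
the interiors of the simplices, so that `Ω` and the union of the simplices differ by a subset of
the faces. -/
structure IsMeshOf (Ω : Set (EuclideanSpace ℝ (Fin d))) : Prop where
  isOpen : IsOpen Ω
  isConnected : IsConnected Ω
  closure_eq : closure Ω = ⋃ T ∈ M.elems, M.cell T
  interior_subset : ∀ T ∈ M.elems, interior (M.cell T) ⊆ Ω

/-- Diameter of the largest ball contained in the simplex. -/
def inDiam (T : Finset (Fin n)) : ℝ :=
  2 * sSup {r : ℝ | 0 < r ∧ ∃ x ∈ M.cell T, Metric.ball x r ⊆ M.cell T}

/-- `|T|^{1/d}`. -/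
def cellSize (T : Finset (Fin n)) : ℝ :=
  (MeasureTheory.volume.real (M.cell T)) ^ ((1 : ℝ) / d)

/-- Shape regularity with shape regularity constant `σ`. -/
def IsShapeRegular (σ : ℝ) : Prop :=
  ∀ T ∈ M.elems, M.inDiam T ≤ M.cellSize T ∧ M.cellSize T ≤ Metric.diam (M.cell T) ∧
    Metric.diam (M.cell T) ≤ σ * M.inDiam T

/-! ### Linear finite elements -/

/-- `w` is the vector of barycentric coordinates of the point `x` of the mesh: the coordinates
with respect to an element containing `x`, extended by zero to the remaining nodes. -/
def IsBarycentric (x : EuclideanSpace ℝ (Fin d)) (w : Fin n → ℝ) : Prop :=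
  ∃ T ∈ M.elems, (∀ i, 0 ≤ w i) ∧ (∀ i, i ∉ T → w i = 0) ∧ ∑ i, w i = 1 ∧
    ∑ i, w i • M.node i = x

open Classical in
/-- The nodal basis function `φ_i` of the space of continuous piecewise linear functions on the
mesh (extended by zero): on every element it is the barycentric coordinate of node `i`. -/
def hat (i : Fin n) (x : EuclideanSpace ℝ (Fin d)) : ℝ :=
  if h : ∃ w, M.IsBarycentric x w then h.choose i else 0

/-- The stiffness matrix `a(φ_j, φ_i) = ∫_Ω α ∇φ_j · ∇φ_i` of the pure Neumann problem for
`-∇·(α∇u) = f` on `Ω`. (The `φ_i` are affine on each element, so that their classical gradient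
exists, and is the weak gradient, off the null set of the faces.) -/
def stiffness (Ω : Set (EuclideanSpace ℝ (Fin d))) (α : EuclideanSpace ℝ (Fin d) → ℝ) :
    Matrix (Fin n) (Fin n) ℝ :=
  Matrix.of fun i j => ∫ x in Ω, α x * ⟪gradient (M.hat j) x, gradient (M.hat i) x⟫_ℝ

end SimplicialMesh

open Classical in
/-- The jump coefficient: `ε` on `Ω₁` and `1` on `Ω₂`. -/
def jumpCoeff {d : ℕ} (Ω₁ Ω₂ : Set (EuclideanSpace ℝ (Fin d))) (ε : ℝ)
    (x : EuclideanSpace ℝ (Fin d)) : ℝ :=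
  if x ∈ Ω₁ then ε else if x ∈ Ω₂ then 1 else 0

/-- `Ω` is split into the two subdomains `Ω₁` and `Ω₂`, and the interface is aligned with the
mesh: (the interior of) every element lies in one of them. -/
structure IsAlignedSplitting {d n : ℕ} (M : SimplicialMesh d n)
    (Ω Ω₁ Ω₂ : Set (EuclideanSpace ℝ (Fin d))) : Prop where
  subset_left : Ω₁ ⊆ Ω
  subset_right : Ω₂ ⊆ Ω
  disjoint : Disjoint Ω₁ Ω₂
  aligned : ∀ T ∈ M.elems, interior (M.cell T) ⊆ Ω₁ ∨ interior (M.cell T) ⊆ Ω₂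

/-! ### Strength of connection and the filtered matrix -/

section Strength

variable {n : ℕ} (A : Matrix (Fin n) (Fin n) ℝ)

/-- `min_{k ≠ i} a_{ik}`. -/
def offDiagMin (i : Fin n) : ℝ := ⨅ k : {k : Fin n // k ≠ i}, A i k

/-- The symmetrized strength function
`s_c(i,j) = a_{ij} / min (min_{k ≠ i} a_{ik}, min_{k ≠ j} a_{jk})`. -/
def strength (i j : Fin n) : ℝ := A i j / min (offDiagMin A i) (offDiagMin A j)

/-- The graph of strong connections: `i ≠ j` are joined if `s_c(i,j) > θ` (the relation is
symmetric for symmetric `A`). -/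
def strongGraph (θ : ℝ) : SimpleGraph (Fin n) :=
  SimpleGraph.fromRel fun i j => θ < strength A i j

open Classical in
/-- The matrix of `(A_S u, v) = ∑_{e = (i,j) ∈ G} ω_e (u_i - u_j) (v_i - v_j)`, `ω_e = -a_{ij}`,
where `G` is the graph of strong connections. -/
def filtered (G : SimpleGraph (Fin n)) : Matrix (Fin n) (Fin n) ℝ :=
  Matrix.of fun i j =>
    if i = j then ∑ k, (if G.Adj i k then -A i k else 0) else if G.Adj i j then A i j else 0

end Strength

/-! ### C/F splitting, local spaces and interpolation -/

section Coarse

variable {n : ℕ}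

/-- `C` is a maximal independent set (MIS) of the graph `G`. -/
def IsMIS (G : SimpleGraph (Fin n)) (C : Finset (Fin n)) : Prop :=
  Maximal (fun s : Finset (Fin n) => G.IsIndepSet (s : Set (Fin n))) C

/-- The interpolation neighbours `s_j = N_j ∪ ⋃_{i ∈ N_j} N_i` of standard interpolation. -/
def interpNeighbors (G : SimpleGraph (Fin n)) (j : Fin n) : Set (Fin n) :=
  G.neighborSet j ∪ ⋃ i ∈ G.neighborSet j, G.neighborSet i

/-- `Ω_j = {j} ∪ (F ∩ s_j)`, with `F` the complement of `C`. -/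
def patch (G : SimpleGraph (Fin n)) (C : Finset (Fin n)) (j : Fin n) : Set (Fin n) :=
  {j} ∪ ({i | i ∉ C} ∩ interpNeighbors G j)

open Classical in
/-- The operator `Π_j : V_j = ℝ^{Ω_j} → ℝ^n`, `(Π_j v)_i = p_{ij} v_i` for `i ∈ Ω_j` and `0`
otherwise. -/
def localProlong (G : SimpleGraph (Fin n)) (C : Finset (Fin n)) (p : Matrix (Fin n) (Fin n) ℝ)
    (j : Fin n) : (patch G C j → ℝ) →ₗ[ℝ] (Fin n → ℝ) where
  toFun v i := if h : i ∈ patch G C j then p i j * v ⟨i, h⟩ else 0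
  map_add' u v := by
    funext i
    by_cases h : i ∈ patch G C j <;> simp [h, mul_add]
  map_smul' c v := by
    funext i
    by_cases h : i ∈ patch G C j <;> simp [h, mul_left_comm]

/-- The local coarse space `V_j^c` of constant vectors. -/
def localCoarse (G : SimpleGraph (Fin n)) (C : Finset (Fin n)) (j : Fin n) :
    Submodule ℝ (patch G C j → ℝ) :=
  Submodule.span ℝ {fun _ => (1 : ℝ)}

/-- The global coarse space `V_c = ∑_{j ∈ C} Π_j V_j^c`. -/
def coarseSpace (G : SimpleGraph (Fin n)) (C : Finset (Fin n)) (p : Matrix (Fin n) (Fin n) ℝ) :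
    Submodule ℝ (Fin n → ℝ) :=
  ⨆ j : C, (localCoarse G C j).map (localProlong G C p j)

/-- The prolongation matrix, with columns `P_j = Π_j 1`, `j ∈ C`. -/
def prolong (G : SimpleGraph (Fin n)) (C : Finset (Fin n)) (p : Matrix (Fin n) (Fin n) ℝ) :
    Matrix (Fin n) C ℝ :=
  Matrix.of fun i j => localProlong G C p j (fun _ => 1) i

/-- The range of the prolongation matrix is the global coarse space. -/
theorem range_prolong (G : SimpleGraph (Fin n)) (C : Finset (Fin n))
    (p : Matrix (Fin n) (Fin n) ℝ) :
    LinearMap.range (prolong G C p).mulVecLin = coarseSpace G C p := by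
  rw [Matrix.range_mulVecLin, coarseSpace, Submodule.span_range_eq_iSup]
  refine iSup_congr fun j => ?_
  rw [localCoarse, Submodule.map_span, Set.image_singleton]
  rfl

open Classical in
/-- Admissible interpolation weights: they are bounded by one, and `∑_j Π_j χ_j = I`, where `χ_j`
is the restriction to `Ω_j`. -/
structure IsAdmissible (G : SimpleGraph (Fin n)) (C : Finset (Fin n))
    (p : Matrix (Fin n) (Fin n) ℝ) : Prop where
  abs_le_one : ∀ j ∈ C, ∀ i ∈ patch G C j, |p i j| ≤ 1
  partition_of_unity : ∀ v : Fin n → ℝ, ∑ j ∈ C, localProlong G C p j (fun i => v i) = v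

/-- The entries obtained from row `i` of `A` by eliminating the `F`-neighbours `k` of `i`
through `e_k = -∑_{l ≠ k} a_{kl} e_l / a_{kk}`. -/
def eliminated (A : Matrix (Fin n) (Fin n) ℝ) (C : Finset (Fin n)) (i j : Fin n) : ℝ :=
  A i j - ∑ k ∈ (Finset.univ \ C).erase i, A i k * A k j / A k k

/-- The weights of standard interpolation: `e_i = e_i` at a coarse point, and interpolation with
weights proportional to the eliminated row at a fine point. -/
def standardWeights (A : Matrix (Fin n) (Fin n) ℝ) (C : Finset (Fin n)) :
    Matrix (Fin n) (Fin n) ℝ :=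
  Matrix.of fun i j =>
    if i ∈ C then (if i = j then 1 else 0)
    else if j ∈ C then eliminated A C i j / ∑ l ∈ C, eliminated A C i l
    else 0

end Coarse

/-! ### The exact two-level method -/

section TwoLevel

/-- The Moore-Penrose pseudo-inverse of a real symmetric matrix: with `M = U diag(λ) Uᵀ`, it is
`U diag(λ⁻¹) Uᵀ`, where `0⁻¹ = 0`. -/
def pinv {m : Type*} [Fintype m] [DecidableEq m] (M : Matrix m m ℝ) : Matrix m m ℝ :=
  open Classical in
  if h : M.IsHermitian then
    (h.eigenvectorUnitary : Matrix m m ℝ) * Matrix.diagonal (fun k => (h.eigenvalues k)⁻¹) *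
      (h.eigenvectorUnitary : Matrix m m ℝ)ᵀ
  else 0

/-- `pinv M` satisfies the four Penrose equations. -/
theorem pinv_spec {m : Type*} [Fintype m] [DecidableEq m] {M : Matrix m m ℝ}
    (hM : M.IsHermitian) :
    M * pinv M * M = M ∧ pinv M * M * pinv M = pinv M ∧
      (M * pinv M)ᵀ = M * pinv M ∧ (pinv M * M)ᵀ = pinv M * M := by
  set U : Matrix m m ℝ := (hM.eigenvectorUnitary : Matrix m m ℝ) with hU
  set l := hM.eigenvalues with hl
  have hUU : Uᵀ * U = 1 := by
    have := Unitary.coe_star_mul_self hM.eigenvectorUnitary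
    simpa [Matrix.star_eq_conjTranspose] using this
  have hM' : M = U * Matrix.diagonal l * Uᵀ := by
    have := hM.spectral_theorem
    simpa [Unitary.conjStarAlgAut_apply, Matrix.star_eq_conjTranspose, Function.comp_def] using this
  have hP : pinv M = U * Matrix.diagonal (fun k => (l k)⁻¹) * Uᵀ := by
    rw [pinv, dif_pos hM]
  have key : ∀ a b : m → ℝ, (U * Matrix.diagonal a * Uᵀ) * (U * Matrix.diagonal b * Uᵀ)
      = U * Matrix.diagonal (fun k => a k * b k) * Uᵀ := by
    intro a b
    calc _ = U * Matrix.diagonal a * (Uᵀ * U) * Matrix.diagonal b * Uᵀ := by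
          simp only [Matrix.mul_assoc]
      _ = _ := by
          rw [hUU, Matrix.mul_one, Matrix.mul_assoc U, Matrix.diagonal_mul_diagonal]
  have keyT : ∀ a : m → ℝ, (U * Matrix.diagonal a * Uᵀ)ᵀ = U * Matrix.diagonal a * Uᵀ := by
    intro a
    simp [Matrix.transpose_mul, Matrix.mul_assoc]
  have e1 : M * pinv M = U * Matrix.diagonal (fun k => l k * (l k)⁻¹) * Uᵀ := by
    rw [hP]; nth_rewrite 1 [hM']; exact key _ _
  have e2 : pinv M * M = U * Matrix.diagonal (fun k => (l k)⁻¹ * l k) * Uᵀ := by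
    rw [hP]; nth_rewrite 1 [hM']; exact key _ _
  refine ⟨?_, ?_, ?_, ?_⟩
  · rw [e1]; nth_rewrite 1 [hM']; rw [key]; refine Eq.trans ?_ hM'.symm
    congr 3; funext k; by_cases h : l k = 0 <;> simp [h]
  · rw [e2]; nth_rewrite 1 [hP]; rw [key, hP]
    congr 3; funext k; by_cases h : l k = 0 <;> simp [h]
  · rw [e1, keyT]
  · rw [e2, keyT]

variable {n : ℕ} {ι : Type*} [Fintype ι] [DecidableEq ι]

/-- The two-level method: coarse grid correction `w = P A_c† Pᵀ g` with `A_c = Pᵀ A P`, then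
post-smoothing `B g = w + R (g - A w)`. -/
def twoLevel (A R : Matrix (Fin n) (Fin n) ℝ) (P : Matrix (Fin n) ι ℝ) (g : Fin n → ℝ) :
    Fin n → ℝ :=
  let w := P *ᵥ (pinv (Pᵀ * A * P) *ᵥ (Pᵀ *ᵥ g))
  w + R *ᵥ (g - A *ᵥ w)

/-- The error propagation operator `E = I - B A`. -/
def errorProp (A R : Matrix (Fin n) (Fin n) ℝ) (P : Matrix (Fin n) ι ℝ) (v : Fin n → ℝ) :
    Fin n → ℝ :=
  v - twoLevel A R P (A *ᵥ v)

/-- The square `‖v‖_M² = (M v, v)` of the (semi)norm given by a matrix `M`. -/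
def normSq (M : Matrix (Fin n) (Fin n) ℝ) (v : Fin n → ℝ) : ℝ := (M *ᵥ v) ⬝ᵥ v

/-- The symmetrized smoother, `I - R̄ A = (I - Rᵀ A) (I - R A)`. -/
def symmetrized (A R : Matrix (Fin n) (Fin n) ℝ) : Matrix (Fin n) (Fin n) ℝ :=
  R + Rᵀ - Rᵀ * A * R

/-- The smoother `R` is convergent (its symmetrization is SPD), and its norm is bounded by the
norm of the diagonal `D` of `A`: `‖v‖²_{R̄⁻¹} ≤ c ‖v‖²_D`. -/
structure IsSmoother (A R : Matrix (Fin n) (Fin n) ℝ) (c : ℝ) : Prop where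
  posDef : (symmetrized A R).PosDef
  bound : ∀ v, normSq (symmetrized A R)⁻¹ v ≤ c * normSq (Matrix.diagonal A.diag) v

end TwoLevel

end JumpAMG

end

/-! The proof reduces convergence to a weak approximation property: every v has a coarse vector Px
with ‖v - Px‖_D² ≤ K‖v‖_A². The coarse correction leaves an error u that is A-orthogonal to the
coarse space, so (Au, u) = (Au, u - Py) for every y. Duality between R̄ and its inverse, c^D and the
approximation property give ‖u‖_A² ≤ c^D K ‖Au‖²_R̄, and ‖Au‖²_R̄ is exactly the energy removed by
smoothing (`normSq_sub_smoother`, `normSq_errorProp_le`).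

The coarse vector is v restricted to the coarse points. By the partition of unity its error at i is
a weighted sum of differences v_i - v_j with j within two strong edges of i. Let m_i = -min_{k≠i}
a_ik. Then a_ii ≤ N m_i, a strong edge at i has weight at least θ m_i, and m_k ≥ θ m_i at its other
end. Hence jumps of the coefficient do no harm along strong paths, and the D-norm of the error is
bounded by the energy of the strong edges (`exists_normSq_diagonal_sub_prolong_le`).

That energy is bounded by ‖v‖_A² element by element (`sum_edges_assembled_le`). The coefficient is
constant on an element and multiplies both sides, so ε drops out; only (gradient of a barycentric
coordinate) × (diameter) ≤ σ is needed. The row length N is bounded by a volume packing argument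
around a node (`card_elems_around_le`). -/

namespace JumpAMG

/-! ### Two-level convergence from a weak approximation property. -/

section TwoLevelConvergence

variable {n : ℕ} {ι : Type*} [Fintype ι] [DecidableEq ι]

lemma mulVec_dotProduct_comm_of_isSymm {m : Type*} [Fintype m] {A : Matrix m m ℝ}
    (hA : A.IsSymm) (u v : m → ℝ) : (A *ᵥ u) ⬝ᵥ v = u ⬝ᵥ (A *ᵥ v) := by
  rw [Matrix.dotProduct_mulVec, ← Matrix.mulVec_transpose, hA.eq]

lemma transpose_mulVec_dotProduct {m k : Type*} [Fintype m] [Fintype k] (P : Matrix m k ℝ)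
    (x : m → ℝ) (y : k → ℝ) : (Pᵀ *ᵥ x) ⬝ᵥ y = x ⬝ᵥ (P *ᵥ y) := by
  rw [Matrix.dotProduct_mulVec, ← Matrix.mulVec_transpose]

lemma normSq_add_of_isSymm {A : Matrix (Fin n) (Fin n) ℝ} (hA : A.IsSymm) (u w : Fin n → ℝ) :
    normSq A (u + w) = normSq A u + 2 * ((A *ᵥ u) ⬝ᵥ w) + normSq A w := by
  have : (A *ᵥ w) ⬝ᵥ u = (A *ᵥ u) ⬝ᵥ w := by
    rw [mulVec_dotProduct_comm_of_isSymm hA, dotProduct_comm]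
  simp only [normSq, Matrix.mulVec_add, add_dotProduct, dotProduct_add, this]
  ring

lemma normSq_smul (A : Matrix (Fin n) (Fin n) ℝ) (t : ℝ) (u : Fin n → ℝ) :
    normSq A (t • u) = t ^ 2 * normSq A u := by
  simp only [normSq, Matrix.mulVec_smul, smul_dotProduct, dotProduct_smul, smul_eq_mul]
  ring

/-- A vector of zero energy lies in the kernel of a symmetric positive semidefinite matrix. -/
lemma mulVec_eq_zero_of_normSq_eq_zero {A : Matrix (Fin n) (Fin n) ℝ} (hA : A.IsSymm)
    (hA0 : ∀ v, 0 ≤ normSq A v) {u : Fin n → ℝ} (hu : normSq A u = 0) : A *ᵥ u = 0 := by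
  -- The energy of u + tAu is a nonnegative polynomial in t without constant term, so its linear
  -- coefficient 2‖Au‖² must vanish.
  have key : ∀ t : ℝ, 0 ≤ normSq A (A *ᵥ u) * (t * t) +
      (2 * ((A *ᵥ u) ⬝ᵥ (A *ᵥ u))) * t + 0 := by
    intro t
    have h := hA0 (u + t • (A *ᵥ u))
    rw [normSq_add_of_isSymm hA, hu, normSq_smul, dotProduct_smul, smul_eq_mul] at h
    linarith
  have h := discrim_le_zero key
  have h0 : (A *ᵥ u) ⬝ᵥ (A *ᵥ u) = 0 := by
    have : ((A *ᵥ u) ⬝ᵥ (A *ᵥ u)) ^ 2 ≤ 0 := by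
      unfold discrim at h
      linarith
    exact pow_eq_zero_iff two_ne_zero |>.1 (le_antisymm this (sq_nonneg _))
  exact dotProduct_self_eq_zero.1 h0

/-- The Cauchy-Schwarz inequality for the dual norms of a positive definite matrix. -/
lemma dotProduct_sq_le_normSq_mul_normSq_inv {S : Matrix (Fin n) (Fin n) ℝ} (hS : S.PosDef)
    (x y : Fin n → ℝ) : (x ⬝ᵥ y) ^ 2 ≤ normSq S x * normSq S⁻¹ y := by
  have hsymm : S.IsSymm := by simpa using hS.isHermitian
  have hinv : S *ᵥ (S⁻¹ *ᵥ y) = y := by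
    rw [Matrix.mulVec_mulVec, Matrix.mul_nonsing_inv _ ((Matrix.isUnit_iff_isUnit_det _).1 hS.isUnit),
      Matrix.one_mulVec]
  have hnn : ∀ z, 0 ≤ normSq S z := fun z => by
    have := hS.posSemidef.dotProduct_mulVec_nonneg z
    simpa [normSq, dotProduct_comm] using this
  -- This is the S-energy of S⁻¹y + tx; its nonpositive discriminant is the claim.
  have key : ∀ t : ℝ, 0 ≤ normSq S x * (t * t) + (2 * (x ⬝ᵥ y)) * t + normSq S⁻¹ y := by
    intro t
    have h := hnn (S⁻¹ *ᵥ y + t • x)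
    rw [normSq_add_of_isSymm hsymm, normSq_smul, dotProduct_smul, smul_eq_mul, hinv] at h
    have h1 : normSq S (S⁻¹ *ᵥ y) = normSq S⁻¹ y := by
      rw [normSq, hinv, normSq, dotProduct_comm]
    rw [h1, dotProduct_comm y x] at h
    linarith
  have h := discrim_le_zero key
  unfold discrim at h
  nlinarith

/-- Post-smoothing reduces the energy by the `R̄`-norm of the residual. -/
lemma normSq_sub_smoother {A : Matrix (Fin n) (Fin n) ℝ} (hA : A.IsSymm)
    (R : Matrix (Fin n) (Fin n) ℝ) (u : Fin n → ℝ) :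
    normSq A (u - R *ᵥ (A *ᵥ u)) = normSq A u - normSq (symmetrized A R) (A *ᵥ u) := by
  simp only [normSq, symmetrized, Matrix.sub_mulVec, Matrix.add_mulVec, ← Matrix.mulVec_mulVec,
    sub_dotProduct, add_dotProduct, transpose_mulVec_dotProduct, Matrix.mulVec_sub, dotProduct_sub,
    mulVec_dotProduct_comm_of_isSymm hA (R *ᵥ (A *ᵥ u)) u,
    mulVec_dotProduct_comm_of_isSymm hA (R *ᵥ (A *ᵥ u)) (R *ᵥ (A *ᵥ u))]
  rw [dotProduct_comm (R *ᵥ (A *ᵥ u)) (A *ᵥ u)]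
  ring

/-- The energy norm is bounded by the norm of the inverse of a convergent symmetrized smoother. -/
lemma normSq_le_normSq_symmetrized_inv {A R : Matrix (Fin n) (Fin n) ℝ} (hA : A.IsSymm)
    (hA0 : ∀ v, 0 ≤ normSq A v) (hR : (symmetrized A R).PosDef) (v : Fin n → ℝ) :
    normSq A v ≤ normSq (symmetrized A R)⁻¹ v := by
  have h1 := normSq_sub_smoother hA R v
  have h2 := hA0 (v - R *ᵥ (A *ᵥ v))
  -- `h1` and `h2` give ‖Av‖²_R̄ ≤ ‖v‖_A². Inserted into the duality bound for (Av, v)², this lets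
  -- one factor ‖v‖_A² cancel.
  have h3 := dotProduct_sq_le_normSq_mul_normSq_inv hR (A *ᵥ v) v
  have h4 : 0 ≤ normSq (symmetrized A R)⁻¹ v := by
    have := hR.inv.posSemidef.dotProduct_mulVec_nonneg v
    simpa [normSq, dotProduct_comm] using this
  change normSq A v ^ 2 ≤ _ at h3
  have h5 := hA0 v
  rcases h5.eq_or_lt with h5 | h5
  · rwa [← h5]
  · have : normSq A v * normSq A v ≤ normSq A v * normSq (symmetrized A R)⁻¹ v := by
      rw [← sq]
      exact h3.trans (mul_le_mul_of_nonneg_right (by linarith) h4)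
    exact le_of_mul_le_mul_left this h5

lemma normSq_diagonal (f v : Fin n → ℝ) :
    normSq (Matrix.diagonal f) v = ∑ i, f i * v i ^ 2 := by
  simp only [normSq, dotProduct, Matrix.mulVec_diagonal]
  exact Finset.sum_congr rfl fun i _ => by ring

lemma normSq_single (A : Matrix (Fin n) (Fin n) ℝ) (i : Fin n) :
    normSq A (Pi.single i 1) = A i i := by
  simp [normSq]

/-- The smoother constant is at least one. -/
lemma IsSmoother.one_le {A R : Matrix (Fin n) (Fin n) ℝ} {c : ℝ} (hA : A.IsSymm)
    (hA0 : ∀ v, 0 ≤ normSq A v) (h : IsSmoother A R c) {i : Fin n} (hi : 0 < A i i) : 1 ≤ c := by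
  have h1 := (normSq_le_normSq_symmetrized_inv hA hA0 h.posDef (Pi.single i 1)).trans (h.bound _)
  rw [normSq_single, normSq_single, Matrix.diagonal_apply_eq, Matrix.diag_apply] at h1
  by_contra! hc
  nlinarith

/-- The coarse grid correction leaves an error that is energy orthogonal to the coarse space. -/
lemma transpose_mulVec_coarse_residual {A : Matrix (Fin n) (Fin n) ℝ} (hA : A.IsSymm)
    (hA0 : ∀ v, 0 ≤ normSq A v) (P : Matrix (Fin n) ι ℝ) (v : Fin n → ℝ) :
    Pᵀ *ᵥ (A *ᵥ (v - P *ᵥ (pinv (Pᵀ * A * P) *ᵥ (Pᵀ *ᵥ (A *ᵥ v))))) = 0 := by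
  set M := Pᵀ * A * P with hM
  have hMs : M.IsSymm := by
    rw [Matrix.IsSymm, hM, Matrix.transpose_mul, Matrix.transpose_mul, hA.eq,
      Matrix.transpose_transpose, Matrix.mul_assoc]
  have hMh : M.IsHermitian := by simpa [Matrix.IsHermitian] using hMs.eq
  obtain ⟨p1, -, p3, -⟩ := pinv_spec hMh
  set b := Pᵀ *ᵥ (A *ᵥ v) with hb
  -- The coarse matrix may be singular, so solvability has to be shown. The defect z lies in the
  -- kernel of M, and zero energy of Pz gives APz = 0; thus z is orthogonal to b and to the range of
  -- M M†, hence to itself.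
  set z := b - (M * pinv M) *ᵥ b with hz
  have hgoal : Pᵀ *ᵥ (A *ᵥ (v - P *ᵥ (pinv M *ᵥ b))) = z := by
    simp only [Matrix.mulVec_sub, hz, hb, hM, Matrix.mulVec_mulVec, Matrix.mul_assoc]
  rw [hgoal]
  have hMM : M * (M * pinv M) = M := by
    have := congrArg Matrix.transpose p1
    rwa [Matrix.transpose_mul, p3, hMs.eq] at this
  have hMz : M *ᵥ z = 0 := by
    have : M *ᵥ ((M * pinv M) *ᵥ b) = M *ᵥ b := by rw [Matrix.mulVec_mulVec, hMM]
    rw [hz, Matrix.mulVec_sub, this, sub_self]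
  have hPz : A *ᵥ (P *ᵥ z) = 0 := by
    refine mulVec_eq_zero_of_normSq_eq_zero hA hA0 ?_
    have : (M *ᵥ z) ⬝ᵥ z = normSq A (P *ᵥ z) := by
      rw [hM, ← Matrix.mulVec_mulVec, ← Matrix.mulVec_mulVec, transpose_mulVec_dotProduct, normSq]
    rw [← this, hMz, zero_dotProduct]
  have hbz : b ⬝ᵥ z = 0 := by
    rw [hb, transpose_mulVec_dotProduct, mulVec_dotProduct_comm_of_isSymm hA, hPz, dotProduct_zero]
  have hMp : (M * pinv M) *ᵥ z = 0 := by
    rw [← p3, Matrix.transpose_mul, hMs.eq, ← Matrix.mulVec_mulVec, hMz, Matrix.mulVec_zero]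
  refine dotProduct_self_eq_zero.1 ?_
  nth_rewrite 1 [hz]
  rw [sub_dotProduct, hbz, mulVec_dotProduct_comm_of_isSymm (by exact p3), hMp, dotProduct_zero,
    sub_zero]

/-- Convergence of the exact two-level method from the approximation property of the coarse
space. -/
theorem normSq_errorProp_le {A R : Matrix (Fin n) (Fin n) ℝ} (hA : A.IsSymm)
    (hA0 : ∀ v, 0 ≤ normSq A v) {c K : ℝ} (hR : IsSmoother A R c) (hc : 1 ≤ c) (hK : 1 ≤ K)
    (P : Matrix (Fin n) ι ℝ)
    (happ : ∀ v, ∃ x, normSq (Matrix.diagonal A.diag) (v - P *ᵥ x) ≤ K * normSq A v)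
    (v : Fin n → ℝ) :
    normSq A (errorProp A R P v) ≤ (1 - 1 / (c * K)) * normSq A v := by
  set x := pinv (Pᵀ * A * P) *ᵥ (Pᵀ *ᵥ (A *ᵥ v)) with hx
  set u := v - P *ᵥ x with hu
  have horth : ∀ y, (A *ᵥ u) ⬝ᵥ (P *ᵥ y) = 0 := fun y => by
    rw [← transpose_mulVec_dotProduct, hu, hx, transpose_mulVec_coarse_residual hA hA0, zero_dotProduct]
  have hE : errorProp A R P v = u - R *ᵥ (A *ᵥ u) := by
    simp only [errorProp, twoLevel, ← hx, hu, Matrix.mulVec_sub]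
    abel
  have huv : normSq A u ≤ normSq A v := by
    have h : v = u + P *ᵥ x := by simp [hu]
    have h1 := normSq_add_of_isSymm hA u (P *ᵥ x)
    rw [← h, horth] at h1
    have := hA0 (P *ᵥ x)
    linarith
  have hcK : 1 ≤ c * K := one_le_mul_of_one_le_of_one_le hc hK
  have hred : normSq A u ≤ c * K * normSq (symmetrized A R) (A *ᵥ u) := by
    -- The approximation property is applied to u rather than v; orthogonality allows Py to be
    -- subtracted for free in (Au, u).
    obtain ⟨y, hy⟩ := happ u
    have h1 := dotProduct_sq_le_normSq_mul_normSq_inv hR.posDef (A *ᵥ u) (u - P *ᵥ y)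
    rw [dotProduct_sub, horth, sub_zero] at h1
    change normSq A u ^ 2 ≤ _ at h1
    have h2 := hR.bound (u - P *ᵥ y)
    have h3 : 0 ≤ normSq (symmetrized A R) (A *ᵥ u) := by
      have := hR.posDef.posSemidef.dotProduct_mulVec_nonneg (A *ᵥ u)
      simpa [normSq, dotProduct_comm] using this
    have h4 : normSq (symmetrized A R)⁻¹ (u - P *ᵥ y) ≤ c * (K * normSq A u) :=
      h2.trans (mul_le_mul_of_nonneg_left hy (by linarith))
    rcases (hA0 u).eq_or_lt with h5 | h5
    · rw [← h5]
      positivity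
    · refine le_of_mul_le_mul_right ?_ h5
      have := h1.trans (mul_le_mul_of_nonneg_left h4 h3)
      nlinarith
  rw [hE, normSq_sub_smoother hA]
  have h1 : normSq A u / (c * K) ≤ normSq (symmetrized A R) (A *ᵥ u) := by
    rw [div_le_iff₀ (by positivity)]
    linarith
  have h2 : 0 ≤ 1 - 1 / (c * K) := by
    rw [sub_nonneg, div_le_one (by positivity)]
    exact hcK
  calc _ ≤ normSq A u - normSq A u / (c * K) := by linarith
    _ = (1 - 1 / (c * K)) * normSq A u := by ring
    _ ≤ _ := mul_le_mul_of_nonneg_left huv h2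

end TwoLevelConvergence

end JumpAMG

namespace JumpAMG

/-! ### Strong connections, standard weights and the approximation property. -/

section StrongConnections

variable {n : ℕ} {A : Matrix (Fin n) (Fin n) ℝ} {θ : ℝ}

lemma offDiagMin_le (A : Matrix (Fin n) (Fin n) ℝ) {i k : Fin n} (h : k ≠ i) :
    offDiagMin A i ≤ A i k :=
  ciInf_le (f := fun k : {k : Fin n // k ≠ i} => A i k) (Set.finite_range _).bddBelow ⟨k, h⟩

/-- A zero row sum with positive diagonal forces a negative off-diagonal entry. This also excludes
an empty infimum, whose value would be 0. -/
lemma offDiagMin_neg (hrow : ∀ i, ∑ j, A i j = 0) (hdiag : ∀ i, 0 < A i i) (i : Fin n) :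
    offDiagMin A i < 0 := by
  by_contra! h
  have h1 := hrow i
  rw [← Finset.add_sum_erase _ _ (Finset.mem_univ i)] at h1
  have h2 : 0 ≤ ∑ j ∈ Finset.univ.erase i, A i j := Finset.sum_nonneg fun j hj =>
    h.trans (offDiagMin_le A (Finset.ne_of_mem_erase hj))
  linarith [hdiag i]

/-- The denominator of the strength is negative, so clearing it reverses the inequality; the minimum
is then bounded by either of its arguments. -/
lemma lt_of_strongGraph_adj (hA : A.IsSymm) (hrow : ∀ i, ∑ j, A i j = 0)
    (hdiag : ∀ i, 0 < A i i) (hθ : 0 < θ) {i j : Fin n} (h : (strongGraph A θ).Adj i j) :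
    A i j < θ * offDiagMin A i ∧ A i j < θ * offDiagMin A j := by
  have hs : θ < strength A i j := by
    rcases (SimpleGraph.fromRel_adj _ _ _).1 h with ⟨-, h | h⟩
    · exact h
    · rwa [strength, hA.apply, min_comm] at h
  have hneg : min (offDiagMin A i) (offDiagMin A j) < 0 :=
    min_lt_of_left_lt (offDiagMin_neg hrow hdiag i)
  rw [strength, lt_div_iff_of_neg hneg] at hs
  exact ⟨hs.trans_le (mul_le_mul_of_nonneg_left (min_le_left _ _) hθ.le),
    hs.trans_le (mul_le_mul_of_nonneg_left (min_le_right _ _) hθ.le)⟩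

lemma neg_of_strongGraph_adj (hA : A.IsSymm) (hrow : ∀ i, ∑ j, A i j = 0)
    (hdiag : ∀ i, 0 < A i i) (hθ : 0 < θ) {i j : Fin n} (h : (strongGraph A θ).Adj i j) :
    A i j < 0 :=
  (lt_of_strongGraph_adj hA hrow hdiag hθ h).1.trans
    (mul_neg_of_pos_of_neg hθ (offDiagMin_neg hrow hdiag i))

/-- The row scales at the two ends of a strong edge are comparable up to θ. This is what permits
interpolation over two edges across a jump. -/
lemma offDiagMin_le_of_strongGraph_adj (hA : A.IsSymm) (hrow : ∀ i, ∑ j, A i j = 0)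
    (hdiag : ∀ i, 0 < A i i) (hθ : 0 < θ) {i j : Fin n} (h : (strongGraph A θ).Adj i j) :
    offDiagMin A i ≤ θ * offDiagMin A j :=
  (offDiagMin_le A h.ne').trans (lt_of_strongGraph_adj hA hrow hdiag hθ h).2.le

/-- The diagonal entry is minus the sum of at most N nonzero entries, each at least the row minimum.
Positive off-diagonal entries are allowed. -/
lemma diag_le_of_card_le (hrow : ∀ i, ∑ j, A i j = 0) (hdiag : ∀ i, 0 < A i i) {i : Fin n}
    {N : ℕ} (hN : (Finset.univ.filter fun k => k ≠ i ∧ A i k ≠ 0).card ≤ N) :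
    A i i ≤ N * -offDiagMin A i := by
  have h1 := hrow i
  rw [← Finset.add_sum_erase _ _ (Finset.mem_univ i)] at h1
  have h2 : ∑ j ∈ Finset.univ.erase i, A i j
      = ∑ j ∈ Finset.univ.filter fun k => k ≠ i ∧ A i k ≠ 0, A i j := by
    symm
    refine Finset.sum_subset (fun j hj => ?_) fun j hj hj' => ?_
    · simpa using (Finset.mem_filter.1 hj).2.1
    · by_contra h
      exact hj' (by simpa [h] using hj)
  have h3 : (Finset.univ.filter fun k => k ≠ i ∧ A i k ≠ 0).card • offDiagMin A i
      ≤ ∑ j ∈ Finset.univ.filter fun k => k ≠ i ∧ A i k ≠ 0, A i j :=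
    Finset.card_nsmul_le_sum _ _ _ fun j hj => offDiagMin_le A (Finset.mem_filter.1 hj).2.1
  rw [nsmul_eq_mul] at h3
  have h4 : ((Finset.univ.filter fun k => k ≠ i ∧ A i k ≠ 0).card : ℝ) * -offDiagMin A i
      ≤ N * -offDiagMin A i :=
    mul_le_mul_of_nonneg_right (by exact_mod_cast hN)
      (neg_nonneg.2 (offDiagMin_neg hrow hdiag i).le)
  linarith

lemma filtered_apply_of_ne (G : SimpleGraph (Fin n)) {i j : Fin n} (h : i ≠ j)
    [Decidable (G.Adj i j)] :
    filtered A G i j = if G.Adj i j then A i j else 0 := by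
  simp [filtered, h]

/-- Otherwise i could be added to C, against maximality. -/
lemma IsMIS.exists_adj {G : SimpleGraph (Fin n)} {C : Finset (Fin n)} (hC : IsMIS G C)
    {i : Fin n} (hi : i ∉ C) : ∃ j ∈ C, G.Adj i j := by
  classical
  by_contra! h
  have h1 : G.IsIndepSet ((insert i C : Finset (Fin n)) : Set (Fin n)) := by
    rw [Finset.coe_insert]
    refine hC.prop.insert fun b hb _ => ⟨h b hb, fun h' => h b hb h'.symm⟩
  exact hi (hC.le_of_ge h1 (Finset.subset_insert i C) (Finset.mem_insert_self i C))

lemma mem_patch_iff {G : SimpleGraph (Fin n)} {C : Finset (Fin n)} {i j : Fin n} :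
    i ∈ patch G C j ↔ i = j ∨ i ∉ C ∧ (G.Adj i j ∨ ∃ k, G.Adj i k ∧ G.Adj k j) := by
  simp only [patch, interpNeighbors, Set.singleton_union, Set.mem_insert_iff, Set.mem_inter_iff,
    Set.mem_ofPred_eq, Set.mem_union, SimpleGraph.mem_neighborSet, Set.mem_iUnion, exists_prop]
  simp only [G.adj_comm i, G.adj_comm _ j, and_comm]

open Classical in
lemma localProlong_apply (G : SimpleGraph (Fin n)) (C : Finset (Fin n))
    (p : Matrix (Fin n) (Fin n) ℝ) (j : Fin n) (v : Fin n → ℝ) (i : Fin n) :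
    localProlong G C p j (fun i => v i) i = (if i ∈ patch G C j then p i j else 0) * v i := by
  by_cases h : i ∈ patch G C j <;> simp [localProlong, h]

open Classical in
lemma IsAdmissible.sum_eq_one {G : SimpleGraph (Fin n)} {C : Finset (Fin n)}
    {p : Matrix (Fin n) (Fin n) ℝ} (hp : IsAdmissible G C p) (i : Fin n) :
    ∑ j ∈ C, (if i ∈ patch G C j then p i j else 0) = 1 := by
  have h := congrFun (hp.partition_of_unity fun _ => 1) i
  rw [Finset.sum_apply] at h
  rw [← h]
  exact Finset.sum_congr rfl fun j _ => by
    rw [localProlong_apply G C p j (fun _ => 1) i, mul_one]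

open Classical in
lemma isAdmissible_of_sum_eq_one {G : SimpleGraph (Fin n)} {C : Finset (Fin n)}
    {p : Matrix (Fin n) (Fin n) ℝ} (h1 : ∀ j ∈ C, ∀ i ∈ patch G C j, |p i j| ≤ 1)
    (h2 : ∀ i, ∑ j ∈ C, (if i ∈ patch G C j then p i j else 0) = 1) : IsAdmissible G C p := by
  refine ⟨h1, fun v => ?_⟩
  funext i
  rw [Finset.sum_apply]
  simp only [localProlong_apply]
  rw [← Finset.sum_mul, h2, one_mul]

/-- The weights of standard interpolation for the filtered matrix are admissible. -/
theorem isAdmissible_standardWeights (hA : A.IsSymm) (hrow : ∀ i, ∑ j, A i j = 0)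
    (hdiag : ∀ i, 0 < A i i) (hθ : 0 < θ) {C : Finset (Fin n)}
    (hC : IsMIS (strongGraph A θ) C) :
    IsAdmissible (strongGraph A θ) C
      (standardWeights (filtered A (strongGraph A θ)) C) := by
  classical
  set G := strongGraph A θ
  have hneg : ∀ {i j}, G.Adj i j → A i j < 0 := fun h =>
    neg_of_strongGraph_adj hA hrow hdiag hθ h
  have hoff : ∀ {i j}, i ≠ j → filtered A G i j ≤ 0 := fun {i j} h => by
    rw [filtered_apply_of_ne G h]
    split_ifs with h'
    exacts [(hneg h').le, le_rfl]
  have hsupp : ∀ {i j}, i ≠ j → filtered A G i j ≠ 0 → G.Adj i j := fun {i j} h h' => by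
    by_contra h''
    exact h' (by rw [filtered_apply_of_ne G h, if_neg h''])
  have hdg : ∀ i, 0 ≤ filtered A G i i := fun i => by
    simp only [filtered, Matrix.of_apply, if_true]
    refine Finset.sum_nonneg fun k _ => ?_
    split_ifs with h'
    exacts [(neg_pos.2 (hneg h')).le, le_rfl]
  have hterm : ∀ {i j k}, j ∈ C → k ∈ (Finset.univ \ C).erase i →
      k ≠ i ∧ k ≠ j := fun {i j k} hj hk => by
    simp only [Finset.mem_erase, Finset.mem_sdiff, Finset.mem_univ, true_and] at hk
    exact ⟨hk.1, fun h => hk.2 (h ▸ hj)⟩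
  -- Both off-diagonal factors are nonpositive, so elimination only makes an entry more negative. A
  -- zero pivot is harmless: the quotient is then 0.
  have hle : ∀ {i j}, j ∈ C → eliminated (filtered A G) C i j ≤ filtered A G i j :=
    fun {i j} hj => by
      refine sub_le_self _ (Finset.sum_nonneg fun k hk => ?_)
      obtain ⟨h1, h2⟩ := hterm hj hk
      exact div_nonneg (mul_nonneg_of_nonpos_of_nonpos (hoff h1.symm) (hoff h2)) (hdg k)
  have hnp : ∀ {i j}, i ∉ C → j ∈ C → eliminated (filtered A G) C i j ≤ 0 := fun hi hj =>
    (hle hj).trans (hoff fun h => hi (h ▸ hj))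
  -- A nonzero eliminated entry comes from a strong path of length one or two, which is what the
  -- patch allows.
  have hmem : ∀ {i j}, i ∉ C → j ∈ C → eliminated (filtered A G) C i j ≠ 0 →
      i ∈ patch G C j := fun {i j} hi hj h => by
    rw [mem_patch_iff]
    refine Or.inr ⟨hi, ?_⟩
    by_contra! h'
    have h1 : filtered A G i j = 0 := by
      by_contra h1
      exact h'.1 (hsupp (fun h => hi (h ▸ hj)) h1)
    refine h ?_
    rw [eliminated, h1, zero_sub, neg_eq_zero]
    refine Finset.sum_eq_zero fun k hk => ?_
    obtain ⟨h2, h3⟩ := hterm hj hk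
    by_cases h4 : filtered A G i k = 0
    · simp [h4]
    · have h5 : filtered A G k j = 0 := by
        by_contra h5
        exact h'.2 k (hsupp h2.symm h4) (hsupp h3 h5)
      simp [h5]
  -- Maximality of C supplies a strong coarse neighbour, so the normalizing sum is nonzero.
  have hsum : ∀ {i}, i ∉ C → ∑ l ∈ C, eliminated (filtered A G) C i l < 0 := fun {i} hi => by
    obtain ⟨j, hj, hij⟩ := hC.exists_adj hi
    refine Finset.sum_neg' (fun l hl => hnp hi hl) ⟨j, hj, (hle hj).trans_lt ?_⟩
    rw [filtered_apply_of_ne G hij.ne, if_pos hij]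
    exact hneg hij
  refine isAdmissible_of_sum_eq_one (fun j hj i _ => ?_) fun i => ?_
  · by_cases hi : i ∈ C
    · by_cases hij : i = j <;> simp [standardWeights, hi, hj, hij]
    · simp only [standardWeights, Matrix.of_apply, hi, hj, if_true, if_false]
      rw [abs_div, abs_of_neg (hsum hi), abs_of_nonpos (hnp hi hj),
        div_le_one (neg_pos.2 (hsum hi)), neg_le_neg_iff]
      rw [← Finset.add_sum_erase _ _ hj]
      linarith [Finset.sum_nonpos fun l (hl : l ∈ C.erase j) =>
        hnp hi (Finset.mem_of_mem_erase hl)]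
  · by_cases hi : i ∈ C
    · rw [Finset.sum_eq_single_of_mem i hi]
      · rw [if_pos (mem_patch_iff.2 (Or.inl rfl))]
        simp [standardWeights, hi]
      · intro j _ hj
        simp [standardWeights, hi, hj.symm]
    · have : ∀ j ∈ C, (if i ∈ patch G C j then standardWeights (filtered A G) C i j else 0)
          = eliminated (filtered A G) C i j / ∑ l ∈ C, eliminated (filtered A G) C i l := by
        intro j hj
        simp only [standardWeights, Matrix.of_apply, hi, hj, if_true, if_false]
        split_ifs with h
        · rfl
        · have : eliminated (filtered A G) C i j = 0 := by
            by_contra h'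
            exact h (hmem hi hj h')
          simp [this]
      rw [Finset.sum_congr rfl this, ← Finset.sum_div, div_self (hsum hi).ne]

open Classical in
/-- The approximation property of the coarse space in terms of the strong connections. -/
theorem exists_normSq_diagonal_sub_prolong_le (hA : A.IsSymm) (hrow : ∀ i, ∑ j, A i j = 0)
    (hdiag : ∀ i, 0 < A i i) (hθ : 0 < θ) (hθ' : θ < 1) {N : ℕ}
    (hN : ∀ i, (Finset.univ.filter fun k => k ≠ i ∧ A i k ≠ 0).card ≤ N)
    {C : Finset (Fin n)} {p : Matrix (Fin n) (Fin n) ℝ}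
    (hp : IsAdmissible (strongGraph A θ) C p) (v : Fin n → ℝ) :
    ∃ x : C → ℝ, normSq (Matrix.diagonal A.diag) (v - prolong (strongGraph A θ) C p *ᵥ x) ≤
      N * (1 + N + N * N : ℕ) ^ 2 * (2 / θ ^ 2) * (1 + N) *
        ∑ i, ∑ j, if (strongGraph A θ).Adj i j then -A i j * (v i - v j) ^ 2 else 0 := by
  set G := strongGraph A θ
  have hnegA : ∀ {i j}, G.Adj i j → A i j < 0 := fun h =>
    neg_of_strongGraph_adj hA hrow hdiag hθ h
  -- The row scale m_i replaces the diagonal entry, to which it is comparable from above by a factor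
  -- N.
  set m : Fin n → ℝ := fun i => -offDiagMin A i with hm
  have hm0 : ∀ i, 0 < m i := fun i => neg_pos.2 (offDiagMin_neg hrow hdiag i)
  have hmA : ∀ {i j}, G.Adj i j → θ * m i ≤ -A i j := fun {i j} h => by
    have := (lt_of_strongGraph_adj hA hrow hdiag hθ h).1
    simp only [hm]
    linarith
  have hmm : ∀ {i j}, G.Adj i j → θ * m i ≤ m j := fun {i j} h => by
    have := offDiagMin_le_of_strongGraph_adj hA hrow hdiag hθ h.symm
    simp only [hm]
    linarith
  set S : Fin n → ℝ := fun i => ∑ j, if G.Adj i j then -A i j * (v i - v j) ^ 2 else 0 with hS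
  have hterm : ∀ i j, 0 ≤ if G.Adj i j then -A i j * (v i - v j) ^ 2 else 0 := fun i j => by
    split_ifs with h
    · exact mul_nonneg (neg_pos.2 (hnegA h)).le (sq_nonneg _)
    · exact le_rfl
  have hS0 : ∀ i, 0 ≤ S i := fun i => Finset.sum_nonneg fun j _ => hterm i j
  have hedge : ∀ {i j}, G.Adj i j → θ * (m i * (v i - v j) ^ 2) ≤ S i := fun {i j} h => by
    have h1 := Finset.single_le_sum (fun j _ => hterm i j) (Finset.mem_univ j)
    rw [if_pos h] at h1
    refine le_trans ?_ h1
    rw [← mul_assoc]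
    exact mul_le_mul_of_nonneg_right (hmA h) (sq_nonneg _)
  set nb : Fin n → Finset (Fin n) := fun i => Finset.univ.filter fun k => G.Adj i k with hnb
  have hmem_nb : ∀ {i k}, k ∈ nb i ↔ G.Adj i k := by simp [hnb]
  have hnbN : ∀ i, (nb i).card ≤ N := fun i => by
    refine (Finset.card_le_card fun k hk => ?_).trans (hN i)
    have := hmem_nb.1 hk
    simpa using ⟨this.ne', (hnegA this).ne⟩
  -- Q_i collects the energy at i and at its strong neighbours, enough to control every strong path
  -- of length two from i.
  set Q : Fin n → ℝ := fun i => S i + ∑ k ∈ nb i, S k with hQ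
  have hQS : ∀ i, S i ≤ Q i := fun i =>
    le_add_of_nonneg_right (Finset.sum_nonneg fun k _ => hS0 k)
  have hQS' : ∀ {i k}, G.Adj i k → S i + S k ≤ Q i := fun {i k} h => by
    have := Finset.single_le_sum (fun k _ => hS0 k) (hmem_nb.2 h)
    simp only [hQ]
    linarith
  have hQ0 : ∀ i, 0 ≤ Q i := fun i => (hS0 i).trans (hQS i)
  set J : Fin n → Finset (Fin n) := fun i => C.filter fun j => i ∈ patch G C j with hJ
  have hJcard : ∀ i, (J i).card ≤ 1 + N + N * N := fun i => by
    have hsub : J i ⊆ ({i} ∪ nb i) ∪ (nb i).biUnion nb := fun j hj => by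
      have h1 := mem_patch_iff.1 (Finset.mem_filter.1 hj).2
      simp only [Finset.mem_union, Finset.mem_singleton, Finset.mem_biUnion, hmem_nb]
      rcases h1 with h1 | ⟨-, h1 | h1⟩
      exacts [Or.inl (Or.inl h1.symm), Or.inl (Or.inr h1), Or.inr h1]
    refine (Finset.card_le_card hsub).trans ((Finset.card_union_le _ _).trans ?_)
    refine add_le_add ((Finset.card_union_le _ _).trans ?_) ?_
    · simpa using hnbN i
    · exact (Finset.card_biUnion_le_card_mul _ _ _ fun k _ => hnbN k).trans
        (Nat.mul_le_mul_right _ (hnbN i))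
  -- On a path i, k, j one factor θ comes from the edge (k, j) and a second from passing from m_i to
  -- m_k. The 2 is from (a + b)² ≤ 2a² + 2b². Shorter paths fit the same constant since θ² ≤ θ.
  have hpair : ∀ i, ∀ j ∈ J i, m i * (p i j * (v i - v j)) ^ 2 ≤ 2 / θ ^ 2 * Q i := by
    intro i j hj
    obtain ⟨hjC, hij⟩ := Finset.mem_filter.1 hj
    have hp1 : p i j ^ 2 ≤ 1 := (sq_le_one_iff_abs_le_one _).2 (hp.abs_le_one j hjC i hij)
    have h1 : m i * (p i j * (v i - v j)) ^ 2 ≤ m i * (v i - v j) ^ 2 := by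
      refine mul_le_mul_of_nonneg_left ?_ (hm0 i).le
      rw [mul_pow]
      exact mul_le_of_le_one_left (sq_nonneg _) hp1
    refine h1.trans ?_
    rw [div_mul_eq_mul_div, le_div_iff₀ (by positivity)]
    have hθ2 : θ ^ 2 ≤ θ := by nlinarith
    rcases mem_patch_iff.1 hij with rfl | ⟨-, h | ⟨k, hik, hkj⟩⟩
    · simpa using hQ0 i
    · have h2 := hedge h
      have h3 : 0 ≤ m i * (v i - v j) ^ 2 := mul_nonneg (hm0 i).le (sq_nonneg _)
      nlinarith [hQS i, hQ0 i]
    · have h2 := hedge hik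
      have h3 := hedge hkj
      have h4 : 0 ≤ m i * (v i - v k) ^ 2 := mul_nonneg (hm0 i).le (sq_nonneg _)
      have h5 : θ ^ 2 * (m i * (v k - v j) ^ 2) ≤ S k := by
        refine le_trans ?_ h3
        have := mul_le_mul_of_nonneg_right (hmm hik) (sq_nonneg (v k - v j))
        nlinarith
      have h6 : θ ^ 2 * (m i * (v i - v k) ^ 2) ≤ S i :=
        (mul_le_mul_of_nonneg_right hθ2 h4).trans h2
      have h7 : (v i - v j) ^ 2 ≤ 2 * (v i - v k) ^ 2 + 2 * (v k - v j) ^ 2 := by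
        nlinarith [sq_nonneg ((v i - v k) - (v k - v j))]
      have h8 := mul_le_mul_of_nonneg_left h7 (mul_nonneg (sq_nonneg θ) (hm0 i).le)
      nlinarith [hQS' hik]
  refine ⟨fun j => v j, ?_⟩
  rw [normSq_diagonal]
  have herr : ∀ i, (v - prolong G C p *ᵥ fun j : C => v j) i
      = ∑ j ∈ J i, p i j * (v i - v j) := by
    intro i
    have h1 : (prolong G C p *ᵥ fun j : C => v j) i
        = ∑ j ∈ C, (if i ∈ patch G C j then p i j else 0) * v j := by
      rw [Matrix.mulVec, dotProduct,
        ← Finset.sum_coe_sort C fun j => (if i ∈ patch G C j then p i j else 0) * v j]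
      refine Finset.sum_congr rfl fun j _ => ?_
      rw [prolong, Matrix.of_apply, localProlong_apply G C p j (fun _ => 1) i, mul_one]
    have h2 : v i = ∑ j ∈ C, (if i ∈ patch G C j then p i j else 0) * v i := by
      rw [← Finset.sum_mul, hp.sum_eq_one, one_mul]
    rw [Pi.sub_apply, h1]
    nth_rewrite 1 [h2]
    rw [← Finset.sum_sub_distrib, hJ, Finset.sum_filter]
    refine Finset.sum_congr rfl fun j _ => ?_
    split_ifs <;> ring
  have hpoint : ∀ i, A.diag i * (v - prolong G C p *ᵥ fun j : C => v j) i ^ 2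
      ≤ N * (1 + N + N * N : ℕ) ^ 2 * (2 / θ ^ 2) * Q i := by
    intro i
    have h0 : A.diag i ≤ N * m i := diag_le_of_card_le hrow hdiag (hN i)
    have hc : ((J i).card : ℝ) ≤ (1 + N + N * N : ℕ) := by exact_mod_cast hJcard i
    rw [herr]
    -- One factor |J_i| comes from Cauchy-Schwarz, the other from the number of summands.
    have h1 : m i * (∑ j ∈ J i, p i j * (v i - v j)) ^ 2
        ≤ (1 + N + N * N : ℕ) ^ 2 * (2 / θ ^ 2 * Q i) := by
      calc _ ≤ m i * ((J i).card * ∑ j ∈ J i, (p i j * (v i - v j)) ^ 2) :=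
            mul_le_mul_of_nonneg_left sq_sum_le_card_mul_sum_sq (hm0 i).le
        _ = (J i).card * ∑ j ∈ J i, m i * (p i j * (v i - v j)) ^ 2 := by
            rw [← Finset.mul_sum]
            ring
        _ ≤ (J i).card * ((J i).card • (2 / θ ^ 2 * Q i)) :=
            mul_le_mul_of_nonneg_left (Finset.sum_le_card_nsmul _ _ _ (hpair i))
              (Nat.cast_nonneg _)
        _ = ((J i).card : ℝ) ^ 2 * (2 / θ ^ 2 * Q i) := by
            rw [nsmul_eq_mul]
            ring
        _ ≤ _ := by
            have := hQ0 i
            gcongr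
    calc _ ≤ N * m i * (∑ j ∈ J i, p i j * (v i - v j)) ^ 2 :=
          mul_le_mul_of_nonneg_right h0 (sq_nonneg _)
      _ = N * (m i * (∑ j ∈ J i, p i j * (v i - v j)) ^ 2) := by ring
      _ ≤ N * ((1 + N + N * N : ℕ) ^ 2 * (2 / θ ^ 2 * Q i)) :=
          mul_le_mul_of_nonneg_left h1 (Nat.cast_nonneg _)
      _ = _ := by ring
  have hQsum : ∑ i, Q i ≤ (1 + N) * ∑ i, S i := by
    have h1 : ∑ i, ∑ k ∈ nb i, S k ≤ N * ∑ i, S i := by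
      -- Double counting: each S_k occurs once for each strong neighbour of k, at most N times.
      rw [Finset.sum_comm' (t' := Finset.univ) (s' := nb)
        (by intro x y; simp [hmem_nb, G.adj_comm]), Finset.mul_sum]
      refine Finset.sum_le_sum fun k _ => ?_
      rw [Finset.sum_const, nsmul_eq_mul]
      exact mul_le_mul_of_nonneg_right (by exact_mod_cast hnbN k) (hS0 k)
    simp only [hQ, Finset.sum_add_distrib]
    linarith
  calc _ ≤ ∑ i, N * (1 + N + N * N : ℕ) ^ 2 * (2 / θ ^ 2) * Q i :=
        Finset.sum_le_sum fun i _ => hpoint i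
    _ = N * (1 + N + N * N : ℕ) ^ 2 * (2 / θ ^ 2) * ∑ i, Q i := by rw [Finset.mul_sum]
    _ ≤ N * (1 + N + N * N : ℕ) ^ 2 * (2 / θ ^ 2) * ((1 + N) * ∑ i, S i) :=
        mul_le_mul_of_nonneg_left hQsum (by positivity)
    _ = _ := by ring

end StrongConnections

end JumpAMG

/-! ### Barycentric coordinates and element stiffness matrices. -/

namespace JumpAMG

open MeasureTheory

/-- Weights extended by zero to the whole index set make points of different elements comparable.
They are obtained by summing an arbitrary convex combination over the fibres of a choice of indices.
-/
lemma mem_convexHull_image_iff_exists_weights {ι E : Type*} [Fintype ι] [AddCommGroup E]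
    [Module ℝ E] (f : ι → E) (S : Set ι) (x : E) :
    x ∈ convexHull ℝ (f '' S) ↔ ∃ w : ι → ℝ, (∀ i, 0 ≤ w i) ∧ (∀ i, i ∉ S → w i = 0) ∧
      ∑ i, w i = 1 ∧ ∑ i, w i • f i = x := by
  classical
  constructor
  · rw [mem_convexHull_iff_exists_fintype]
    rintro ⟨κ, _, w, z, hw, hw1, hz, rfl⟩
    choose g hgS hg using hz
    refine ⟨fun i => ∑ k with g k = i, w k, fun i => Finset.sum_nonneg fun k _ => hw k,
      fun i hi => ?_, ?_, ?_⟩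
    · refine Finset.sum_eq_zero fun k hk => ?_
      exact absurd ((Finset.mem_filter.1 hk).2 ▸ hgS k) hi
    · rw [← hw1]
      exact Finset.sum_fiberwise _ _ _
    · rw [← Finset.sum_fiberwise Finset.univ g]
      refine Finset.sum_congr rfl fun i _ => ?_
      rw [Finset.sum_smul]
      refine Finset.sum_congr rfl fun k hk => ?_
      rw [← hg k, (Finset.mem_filter.1 hk).2]
  · rintro ⟨w, hw, hw0, hw1, rfl⟩
    have h1 : ∑ i with i ∈ S, w i = 1 := by
      rw [← hw1]
      exact Finset.sum_subset (Finset.subset_univ _) fun i _ hi => hw0 i (by simpa using hi)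
    have h2 : ∑ i with i ∈ S, w i • f i = ∑ i, w i • f i :=
      Finset.sum_subset (Finset.subset_univ _) fun i _ hi => by
        rw [hw0 i (by simpa using hi), zero_smul]
    rw [← h2]
    exact (convex_convexHull ℝ _).sum_mem (fun i _ => hw i) h1 fun i hi =>
      subset_convexHull ℝ _ ⟨i, (Finset.mem_filter.1 hi).2, rfl⟩

namespace SimplicialMesh

variable {d n : ℕ} (M : SimplicialMesh d n) {T : Finset (Fin n)}

lemma convex_cell (T : Finset (Fin n)) : Convex ℝ (M.cell T) := convex_convexHull ℝ _

lemma isBounded_cell (T : Finset (Fin n)) : Bornology.IsBounded (M.cell T) :=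
  isBounded_convexHull.2 ((Set.toFinite _).image _).isBounded

lemma node_mem_cell {i : Fin n} (hi : i ∈ T) : M.node i ∈ M.cell T :=
  subset_convexHull ℝ _ ⟨i, hi, rfl⟩

/-- The vertices of an element as an affine basis of the space. -/
noncomputable def vertexBasis (hT : T ∈ M.elems) : AffineBasis T ℝ (EuclideanSpace ℝ (Fin d)) where
  toFun i := M.node i
  ind' := M.affineIndependent T hT
  tot' := by
    rw [(M.affineIndependent T hT).affineSpan_eq_top_iff_card_eq_finrank_add_one]
    simp [M.card_elem T hT]

lemma vertexBasis_apply (hT : T ∈ M.elems) (i : T) : M.vertexBasis hT i = M.node i := rfl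

lemma cell_eq_convexHull_range (hT : T ∈ M.elems) :
    M.cell T = convexHull ℝ (Set.range (M.vertexBasis hT)) := by
  rw [cell, Set.image_eq_range]
  rfl

open Classical in
/-- The barycentric coordinate of node `i` with respect to the element `T` (zero if `i` is not a
vertex of `T`). -/
noncomputable def localCoord (T : Finset (Fin n)) (i : Fin n) (x : EuclideanSpace ℝ (Fin d)) : ℝ :=
  if h : T ∈ M.elems ∧ i ∈ T then (M.vertexBasis h.1).coord ⟨i, h.2⟩ x else 0

open Classical in
/-- The gradient of the barycentric coordinate of node `i` with respect to the element `T`. -/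
noncomputable def localGrad (T : Finset (Fin n)) (i : Fin n) : EuclideanSpace ℝ (Fin d) :=
  if h : T ∈ M.elems ∧ i ∈ T then
    (InnerProductSpace.toDual ℝ (EuclideanSpace ℝ (Fin d))).symm
      (LinearMap.toContinuousLinearMap ((M.vertexBasis h.1).coord ⟨i, h.2⟩).linear)
  else 0

lemma localGrad_of_notMem {i : Fin n} (hi : i ∉ T) : M.localGrad T i = 0 := by
  simp [localGrad, hi]

lemma localCoord_of_notMem {i : Fin n} (hi : i ∉ T) (x : EuclideanSpace ℝ (Fin d)) :
    M.localCoord T i x = 0 := by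
  simp [localCoord, hi]

lemma localCoord_of_mem (hT : T ∈ M.elems) {i : Fin n} (hi : i ∈ T)
    (x : EuclideanSpace ℝ (Fin d)) :
    M.localCoord T i x = (M.vertexBasis hT).coord ⟨i, hi⟩ x := by
  rw [localCoord, dif_pos ⟨hT, hi⟩]

/-- Coordinates are affine, so increments are exact; later geometric estimates use the gradient
through this identity. -/
lemma inner_localGrad (T : Finset (Fin n)) (i : Fin n) (x y : EuclideanSpace ℝ (Fin d)) :
    ⟪M.localGrad T i, x - y⟫_ℝ = M.localCoord T i x - M.localCoord T i y := by
  by_cases h : T ∈ M.elems ∧ i ∈ T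
  · rw [localGrad, localCoord, localCoord, dif_pos h, dif_pos h, dif_pos h,
      InnerProductSpace.toDual_symm_apply, LinearMap.coe_toContinuousLinearMap']
    exact AffineMap.linearMap_vsub _ _ _
  · simp [localGrad, localCoord, h]

lemma sum_localCoord (hT : T ∈ M.elems) (x : EuclideanSpace ℝ (Fin d)) :
    ∑ i, M.localCoord T i x = 1 := by
  rw [← Finset.sum_subset (Finset.subset_univ T) fun i _ hi => M.localCoord_of_notMem hi x,
    ← Finset.sum_coe_sort, ← (M.vertexBasis hT).sum_coord_apply_eq_one x]
  exact Finset.sum_congr rfl fun i _ => M.localCoord_of_mem hT i.2 x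

lemma sum_localCoord_smul (hT : T ∈ M.elems) (x : EuclideanSpace ℝ (Fin d)) :
    ∑ i, M.localCoord T i x • M.node i = x := by
  rw [← Finset.sum_subset (Finset.subset_univ T) fun i _ hi => by
      rw [M.localCoord_of_notMem hi x, zero_smul],
    ← Finset.sum_coe_sort]
  conv_rhs => rw [← (M.vertexBasis hT).linear_combination_coord_eq_self x]
  exact Finset.sum_congr rfl fun i _ => by
    rw [M.localCoord_of_mem hT i.2 x, vertexBasis_apply]

/-- Uniqueness of barycentric coordinates; the weights may be negative. -/
lemma localCoord_sum_smul (hT : T ∈ M.elems) {w : Fin n → ℝ} (hw : ∀ i, i ∉ T → w i = 0)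
    (hw1 : ∑ i, w i = 1) (i : Fin n) : M.localCoord T i (∑ k, w k • M.node k) = w i := by
  by_cases hi : i ∈ T
  · have h1 : ∑ k : T, w k = 1 := by
      rw [Finset.sum_coe_sort T w, ← hw1]
      exact Finset.sum_subset (Finset.subset_univ T) fun i _ hi => hw i hi
    have h2 : ∑ k, w k • M.node k
        = Finset.univ.affineCombination ℝ (M.vertexBasis hT) fun k : T => w k := by
      rw [Finset.univ.affineCombination_eq_linear_combination _ _ h1]
      simp only [vertexBasis_apply]
      rw [Finset.sum_coe_sort T fun k => w k • M.node k]
      exact (Finset.sum_subset (Finset.subset_univ T) fun i _ hi => by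
        rw [hw i hi, zero_smul]).symm
    rw [M.localCoord_of_mem hT hi, h2,
      (M.vertexBasis hT).coord_apply_combination_of_mem (Finset.mem_univ _) h1]
  · rw [M.localCoord_of_notMem hi, hw i hi]

lemma localCoord_node (hT : T ∈ M.elems) {j : Fin n} (hj : j ∈ T) (i : Fin n) :
    M.localCoord T i (M.node j) = if i = j then 1 else 0 := by
  have h := M.localCoord_sum_smul hT (w := Pi.single j 1)
    (fun k hk => Pi.single_eq_of_ne (by rintro rfl; exact hk hj) _) (by simp) i
  rw [Pi.single_apply] at h
  rw [← h]
  congr 1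
  simp [Pi.single_apply, ite_smul]

lemma localCoord_nonneg (hT : T ∈ M.elems) {x : EuclideanSpace ℝ (Fin d)} (hx : x ∈ M.cell T)
    (i : Fin n) : 0 ≤ M.localCoord T i x := by
  obtain ⟨w, hw, hw0, hw1, rfl⟩ := (mem_convexHull_image_iff_exists_weights _ _ _).1 hx
  rw [M.localCoord_sum_smul hT (by simpa using hw0) hw1]
  exact hw i

lemma localCoord_le_one (hT : T ∈ M.elems) {x : EuclideanSpace ℝ (Fin d)} (hx : x ∈ M.cell T)
    (i : Fin n) : M.localCoord T i x ≤ 1 := by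
  rw [← M.sum_localCoord hT x]
  exact Finset.single_le_sum (fun k _ => M.localCoord_nonneg hT hx k) (Finset.mem_univ i)

lemma localCoord_pos_of_mem_interior (hT : T ∈ M.elems) {x : EuclideanSpace ℝ (Fin d)}
    (hx : x ∈ interior (M.cell T)) {i : Fin n} (hi : i ∈ T) : 0 < M.localCoord T i x := by
  rw [M.cell_eq_convexHull_range hT, AffineBasis.interior_convexHull] at hx
  rw [M.localCoord_of_mem hT hi]
  exact hx _

variable {M} in
/-- The barycentric coordinates of a point do not depend on the element containing it. -/
lemma IsBarycentric.eq_localCoord {x : EuclideanSpace ℝ (Fin d)} {w : Fin n → ℝ}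
    (h : M.IsBarycentric x w) (hT : T ∈ M.elems) (hx : x ∈ M.cell T) (i : Fin n) :
    w i = M.localCoord T i x := by
  obtain ⟨T', hT', hw, hw0, hw1, hwx⟩ := h
  have hx' : x ∈ M.cell T' :=
    (mem_convexHull_image_iff_exists_weights _ _ _).2 ⟨w, hw, by simpa using hw0, hw1, hwx⟩
  have hxx : x ∈ M.cell T ∩ M.cell T' := ⟨hx, hx'⟩
  rw [cell, cell, M.conforming T hT T' hT'] at hxx
  -- By conformity x has weights u supported on the common nodes, so u gives its coordinates in both
  -- elements.
  obtain ⟨u, -, hu0, hu1, hux⟩ := (mem_convexHull_image_iff_exists_weights _ _ _).1 hxx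
  have h1 := M.localCoord_sum_smul hT (w := u) (fun i hi => hu0 i fun h => hi h.1) hu1 i
  have h2 := M.localCoord_sum_smul hT' (w := u) (fun i hi => hu0 i fun h => hi h.2) hu1 i
  have h3 := M.localCoord_sum_smul hT' hw0 hw1 i
  rw [hux] at h1 h2
  rw [hwx] at h3
  rw [← h3, h2, h1]

lemma hat_eq_localCoord (hT : T ∈ M.elems) {x : EuclideanSpace ℝ (Fin d)} (hx : x ∈ M.cell T)
    (i : Fin n) : M.hat i x = M.localCoord T i x := by
  have h : ∃ w, M.IsBarycentric x w := ⟨fun i => M.localCoord T i x, T, hT,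
    M.localCoord_nonneg hT hx, fun i hi => M.localCoord_of_notMem hi x, M.sum_localCoord hT x,
    M.sum_localCoord_smul hT x⟩
  rw [hat, dif_pos h]
  exact h.choose_spec.eq_localCoord hT hx i

lemma hasGradientAt_localCoord (T : Finset (Fin n)) (i : Fin n)
    (x : EuclideanSpace ℝ (Fin d)) :
    HasGradientAt (M.localCoord T i) (M.localGrad T i) x := by
  have h : M.localCoord T i = fun y =>
      InnerProductSpace.toDual ℝ _ (M.localGrad T i) y + M.localCoord T i 0 := by
    funext y
    rw [InnerProductSpace.toDual_apply_apply]
    have := M.inner_localGrad T i y 0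
    rw [sub_zero] at this
    rw [this, sub_add_cancel]
  rw [hasGradientAt_iff_hasFDerivAt, h]
  exact (ContinuousLinearMap.hasFDerivAt _).add_const _

/-- On an element, the gradient of a nodal basis function is the gradient of the barycentric
coordinate. -/
lemma gradient_hat (hT : T ∈ M.elems) {x : EuclideanSpace ℝ (Fin d)}
    (hx : x ∈ interior (M.cell T)) (i : Fin n) : gradient (M.hat i) x = M.localGrad T i := by
  have h : M.hat i =ᶠ[nhds x] M.localCoord T i := by
    filter_upwards [isOpen_interior.mem_nhds hx] with y hy
    exact M.hat_eq_localCoord hT (interior_subset hy) i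
  exact ((M.hasGradientAt_localCoord T i x).congr_of_eventuallyEq h).gradient

/-- A common point lies in the hull of the common nodes, so its coordinate at a vertex of T outside
T' is zero, whereas interior points have positive coordinates. -/
lemma disjoint_interior_cell {T T' : Finset (Fin n)} (hT : T ∈ M.elems) (hT' : T' ∈ M.elems)
    (h : T ≠ T') : Disjoint (interior (M.cell T)) (interior (M.cell T')) := by
  rw [Set.disjoint_left]
  intro x hx hx'
  obtain ⟨i, hi, hi'⟩ : ∃ i ∈ T, i ∉ T' := by
    by_contra! hsub
    exact h (Finset.eq_of_subset_of_card_le hsub (by rw [M.card_elem T hT, M.card_elem T' hT']))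
  have hxx : x ∈ M.cell T ∩ M.cell T' := ⟨interior_subset hx, interior_subset hx'⟩
  rw [cell, cell, M.conforming T hT T' hT'] at hxx
  obtain ⟨u, -, hu0, hu1, hux⟩ := (mem_convexHull_image_iff_exists_weights _ _ _).1 hxx
  have h1 := M.localCoord_sum_smul hT (w := u) (fun i hi => hu0 i fun h => hi h.1) hu1 i
  rw [hux, hu0 i fun h => hi' h.2] at h1
  exact (M.localCoord_pos_of_mem_interior hT hx hi).ne' h1

lemma volume_cell_ne_top (T : Finset (Fin n)) : volume (M.cell T) ≠ ⊤ :=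
  (M.isBounded_cell T).measure_lt_top.ne

lemma volume_interior_cell (T : Finset (Fin n)) :
    volume (interior (M.cell T)) = volume (M.cell T) :=
  measure_congr (interior_ae_eq_of_null_frontier ((M.convex_cell T).addHaar_frontier volume))

variable {M} in
-- What Ω has beyond the open elements lies on their frontiers, which are null by convexity.
lemma IsMeshOf.ae_eq {Ω : Set (EuclideanSpace ℝ (Fin d))} (h : M.IsMeshOf Ω) :
    Ω =ᵐ[volume] ⋃ T ∈ M.elems, interior (M.cell T) := by
  refine Filter.EventuallyLE.antisymm ?_ ?_
  · rw [ae_le_set]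
    have hnull : volume (⋃ T ∈ M.elems, frontier (M.cell T)) = 0 :=
      (measure_biUnion_null_iff M.elems.countable_toSet).2 fun T _ =>
        (M.convex_cell T).addHaar_frontier volume
    refine measure_mono_null (fun x hx => ?_) hnull
    have hx1 := subset_closure hx.1
    rw [h.closure_eq] at hx1
    have hx2 := hx.2
    simp only [Set.mem_iUnion, exists_prop, not_exists, not_and] at hx1 hx2 ⊢
    obtain ⟨T, hT, hxT⟩ := hx1
    exact ⟨T, hT, subset_closure hxT, hx2 T hT⟩
  · exact (Set.iUnion₂_subset h.interior_subset).eventuallyLE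

lemma IsMeshOf.elems_nonempty {M : SimplicialMesh d n} {Ω : Set (EuclideanSpace ℝ (Fin d))}
    (h : M.IsMeshOf Ω) : M.elems.Nonempty := by
  obtain ⟨x, hx⟩ := h.isConnected.nonempty
  have hx1 := subset_closure hx
  rw [h.closure_eq] at hx1
  simp only [Set.mem_iUnion, exists_prop] at hx1
  exact ⟨_, hx1.choose_spec.1⟩

open Classical in
/-- The stiffness matrix is the sum of the element stiffness matrices. -/
theorem stiffness_jumpCoeff_apply {Ω Ω₁ Ω₂ : Set (EuclideanSpace ℝ (Fin d))}
    (hΩ : M.IsMeshOf Ω) (hs : IsAlignedSplitting M Ω Ω₁ Ω₂) (ε : ℝ) (i j : Fin n) :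
    M.stiffness Ω (jumpCoeff Ω₁ Ω₂ ε) i j = ∑ T ∈ M.elems,
      (if interior (M.cell T) ⊆ Ω₁ then ε else 1) * volume.real (M.cell T) *
        ⟪M.localGrad T j, M.localGrad T i⟫_ℝ := by
  have hconst : ∀ T ∈ M.elems, ∀ x ∈ interior (M.cell T), jumpCoeff Ω₁ Ω₂ ε x *
      ⟪gradient (M.hat j) x, gradient (M.hat i) x⟫_ℝ
        = (if interior (M.cell T) ⊆ Ω₁ then ε else 1) *
          ⟪M.localGrad T j, M.localGrad T i⟫_ℝ := by
    intro T hT x hx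
    rw [M.gradient_hat hT hx, M.gradient_hat hT hx, jumpCoeff]
    by_cases h : interior (M.cell T) ⊆ Ω₁
    · rw [if_pos h, if_pos (h hx)]
    · have h2 := ((hs.aligned T hT).resolve_left h) hx
      rw [if_neg h, if_neg (Set.disjoint_right.1 hs.disjoint h2), if_pos h2]
  rw [stiffness, Matrix.of_apply, setIntegral_congr_set hΩ.ae_eq, integral_biUnion_finset]
  · refine Finset.sum_congr rfl fun T hT => ?_
    rw [setIntegral_congr_fun isOpen_interior.measurableSet (hconst T hT), setIntegral_const,
      smul_eq_mul, measureReal_def, volume_interior_cell, measureReal_def]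
    ring
  · exact fun T _ => isOpen_interior.measurableSet
  · exact fun T hT T' hT' h => M.disjoint_interior_cell hT hT' h
  · intro T hT
    refine IntegrableOn.congr_fun (integrableOn_const ?_) (fun x hx => (hconst T hT x hx).symm)
      isOpen_interior.measurableSet
    rw [volume_interior_cell]
    exact M.volume_cell_ne_top T

/-! ### Element geometry -/

lemma sum_localGrad (hT : T ∈ M.elems) : ∑ i, M.localGrad T i = 0 := by
  refine ext_inner_right ℝ fun x => ?_
  have : ∀ i, ⟪M.localGrad T i, x⟫_ℝ = M.localCoord T i x - M.localCoord T i 0 := fun i => by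
    rw [← M.inner_localGrad, sub_zero]
  rw [sum_inner, inner_zero_left]
  simp only [this, Finset.sum_sub_distrib, M.sum_localCoord hT, sub_self]

/-- Nodal differences along an edge are controlled by the constant gradient of the finite element
function on T. -/
lemma inner_sum_smul_localGrad (hT : T ∈ M.elems) {i j : Fin n} (hi : i ∈ T) (hj : j ∈ T)
    (v : Fin n → ℝ) :
    ⟪∑ k, v k • M.localGrad T k, M.node i - M.node j⟫_ℝ = v i - v j := by
  simp only [sum_inner, real_inner_smul_left, M.inner_localGrad, M.localCoord_node hT hi,
    M.localCoord_node hT hj]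
  simp [mul_sub, Finset.sum_sub_distrib]

lemma exists_ne_of_mem_elem (hd : 1 ≤ d) (hT : T ∈ M.elems) (i : Fin n) :
    ∃ j ∈ T, j ≠ i :=
  Finset.exists_mem_ne (by rw [M.card_elem T hT]; omega) i

lemma localGrad_ne_zero (hd : 1 ≤ d) (hT : T ∈ M.elems) {i : Fin n} (hi : i ∈ T) :
    M.localGrad T i ≠ 0 := by
  intro h
  obtain ⟨j, hj, hji⟩ := M.exists_ne_of_mem_elem hd hT i
  have h1 := M.inner_localGrad T i (M.node i) (M.node j)
  rw [h, inner_zero_left, M.localCoord_node hT hi, M.localCoord_node hT hj, if_pos rfl,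
    if_neg hji.symm] at h1
  norm_num at h1

lemma norm_node_sub_le_diam {i j : Fin n} (hi : i ∈ T) (hj : j ∈ T) :
    ‖M.node i - M.node j‖ ≤ Metric.diam (M.cell T) := by
  rw [← dist_eq_norm]
  exact Metric.dist_le_diam_of_mem (M.isBounded_cell T) (M.node_mem_cell hi) (M.node_mem_cell hj)

lemma diam_cell_pos (hd : 1 ≤ d) (hT : T ∈ M.elems) : 0 < Metric.diam (M.cell T) := by
  obtain ⟨i, hi⟩ : T.Nonempty := Finset.card_pos.1 (by rw [M.card_elem T hT]; omega)
  obtain ⟨j, hj, hji⟩ := M.exists_ne_of_mem_elem hd hT i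
  refine lt_of_lt_of_le (norm_pos_iff.2 fun h => ?_) (M.norm_node_sub_le_diam hi hj)
  have h1 := M.localCoord_node hT hi i
  rw [sub_eq_zero.1 h, M.localCoord_node hT hj, if_neg hji.symm, if_pos rfl] at h1
  norm_num at h1

/-- The inverse estimate for barycentric coordinates. -/
lemma norm_localGrad_mul_inDiam_le (hT : T ∈ M.elems) (i : Fin n) :
    ‖M.localGrad T i‖ * M.inDiam T ≤ 1 := by
  rcases (norm_nonneg (M.localGrad T i)).eq_or_lt with h0 | h0
  · rw [← h0, zero_mul]
    exact zero_le_one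
  have hsup : sSup {r : ℝ | 0 < r ∧ ∃ x ∈ M.cell T, Metric.ball x r ⊆ M.cell T}
      ≤ (2 * ‖M.localGrad T i‖)⁻¹ := by
    refine Real.sSup_le ?_ (by positivity)
    rintro r ⟨hr, x, -, hx⟩
    refine le_of_forall_lt_imp_le_of_dense fun s hs => ?_
    rcases le_or_gt s 0 with hs0 | hs0
    · exact hs0.trans (by positivity)
    -- Both x + e and x - e lie in the cell. Along the gradient the coordinate grows by 2s‖∇λ_i‖
    -- between them, yet it stays in [0, 1].
    set e := (s / ‖M.localGrad T i‖) • M.localGrad T i with he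
    have hen : ‖e‖ = s := by
      rw [he, norm_smul, Real.norm_of_nonneg (by positivity), div_mul_cancel₀ _ h0.ne']
    have h1 : x + e ∈ M.cell T := hx (by simpa [hen] using hs)
    have h2 : x - e ∈ M.cell T := hx (by simpa [dist_eq_norm, hen] using hs)
    have h3 := M.inner_localGrad T i (x + e) (x - e)
    have h4 : (x + e) - (x - e) = (2 : ℝ) • e := by rw [two_smul]; abel
    rw [h4, he, real_inner_smul_right, real_inner_smul_right, real_inner_self_eq_norm_sq] at h3
    have h5 := M.localCoord_le_one hT h1 i
    have h6 := M.localCoord_nonneg hT h2 i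
    have h7 : s / ‖M.localGrad T i‖ * ‖M.localGrad T i‖ ^ 2 = s * ‖M.localGrad T i‖ := by
      field_simp
    rw [h7] at h3
    rw [← one_div, le_div_iff₀ (by positivity)]
    linarith
  calc ‖M.localGrad T i‖ * M.inDiam T
      ≤ ‖M.localGrad T i‖ * (2 * (2 * ‖M.localGrad T i‖)⁻¹) := by
        rw [inDiam]
        gcongr
    _ = 1 := by field_simp

variable {M} in
lemma IsShapeRegular.norm_localGrad_mul_diam_le {σ : ℝ} (hσ : 0 ≤ σ) (h : M.IsShapeRegular σ)
    (hT : T ∈ M.elems) (i : Fin n) : ‖M.localGrad T i‖ * Metric.diam (M.cell T) ≤ σ := by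
  have h1 := M.norm_localGrad_mul_inDiam_le hT i
  have h2 := mul_le_mul_of_nonneg_left (h T hT).2.2 (norm_nonneg (M.localGrad T i))
  nlinarith

variable {M} in
-- The chain diam/σ ≤ inner diameter ≤ |T|^{1/d} is raised to the power d.
lemma IsShapeRegular.le_volume_cell (hd : 1 ≤ d) {σ : ℝ} (hσ : 0 < σ) (h : M.IsShapeRegular σ)
    (hT : T ∈ M.elems) : (Metric.diam (M.cell T) / σ) ^ d ≤ volume.real (M.cell T) := by
  obtain ⟨h1, -, h3⟩ := h T hT
  have h4 : Metric.diam (M.cell T) / σ ≤ M.cellSize T := by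
    rw [div_le_iff₀ hσ]
    nlinarith
  calc (Metric.diam (M.cell T) / σ) ^ d ≤ M.cellSize T ^ d :=
        pow_le_pow_left₀ (div_nonneg Metric.diam_nonneg hσ.le) h4 d
    _ = volume.real (M.cell T) := by
        rw [cellSize, one_div, Real.rpow_inv_natCast_pow measureReal_nonneg (by omega)]

variable {M} in
lemma IsShapeRegular.volume_cell_pos (hd : 1 ≤ d) {σ : ℝ} (hσ : 0 < σ) (h : M.IsShapeRegular σ)
    (hT : T ∈ M.elems) : 0 < volume.real (M.cell T) :=
  (pow_pos (div_pos (M.diam_cell_pos hd hT) hσ) d).trans_le (h.le_volume_cell hd hσ hT)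

variable {M} in
/-- The number of elements around a node of a shape regular mesh is bounded. -/
theorem IsShapeRegular.card_elems_around_le (hd : 1 ≤ d) {σ : ℝ} (hσ : 0 < σ)
    (h : M.IsShapeRegular σ) (i : Fin n) :
    ((M.elems.filter fun T => i ∈ T).card : ℝ) ≤
      σ ^ d * volume.real (Metric.closedBall (0 : EuclideanSpace ℝ (Fin d)) 1) := by
  set s := M.elems.filter fun T => i ∈ T with hs
  have hs1 : ∀ {T}, T ∈ s → T ∈ M.elems := fun hT => (Finset.mem_filter.1 hT).1
  have hs2 : ∀ {T}, T ∈ s → i ∈ T := fun hT => (Finset.mem_filter.1 hT).2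
  have hne : s.Nonempty := by
    obtain ⟨T, hT, hi⟩ := M.node_mem i
    exact ⟨T, Finset.mem_filter.2 ⟨hT, hi⟩⟩
  obtain ⟨T₀, hT₀, hmin⟩ := s.exists_min_image (fun T => Metric.diam (M.cell T)) hne
  set r := Metric.diam (M.cell T₀) with hr
  have hr0 : 0 < r := M.diam_cell_pos hd (hs1 hT₀)
  have hD : ∀ {T}, T ∈ s → 0 < Metric.diam (M.cell T) := fun hT => M.diam_cell_pos hd (hs1 hT)
  have ht0 : ∀ {T}, T ∈ s → 0 < r / Metric.diam (M.cell T) := fun hT => div_pos hr0 (hD hT)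
  have ht1 : ∀ {T}, T ∈ s → r / Metric.diam (M.cell T) ≤ 1 := fun hT =>
    (div_le_one (hD hT)).2 (hmin _ hT)
  -- Each element is shrunk towards the node until its diameter is at most the smallest one, r. The
  -- copies stay disjoint, lie in a ball of radius r and keep volume at least (r/σ)^d, so no
  -- comparison of neighbouring element sizes is needed.
  set f : Finset (Fin n) → Set (EuclideanSpace ℝ (Fin d)) := fun T =>
    AffineMap.homothety (M.node i) (r / Metric.diam (M.cell T)) '' interior (M.cell T) with hf
  have hf1 : ∀ {T}, T ∈ s → f T ⊆ interior (M.cell T) := by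
    rintro T hT _ ⟨y, hy, rfl⟩
    have := (M.convex_cell T).add_smul_sub_mem_interior (M.node_mem_cell (hs2 hT)) hy
      ⟨ht0 hT, ht1 hT⟩
    rwa [AffineMap.homothety_apply, vsub_eq_sub, vadd_eq_add, add_comm]
  have hf2 : ∀ {T}, T ∈ s → f T ⊆ Metric.closedBall (M.node i) r := by
    rintro T hT _ ⟨y, hy, rfl⟩
    rw [Metric.mem_closedBall, dist_eq_norm, AffineMap.homothety_apply, vsub_eq_sub, vadd_eq_add,
      add_sub_cancel_right, norm_smul, Real.norm_of_nonneg (ht0 hT).le]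
    have h1 : ‖y - M.node i‖ ≤ Metric.diam (M.cell T) := by
      rw [← dist_eq_norm]
      exact Metric.dist_le_diam_of_mem (M.isBounded_cell T) (interior_subset hy)
        (M.node_mem_cell (hs2 hT))
    calc _ ≤ r / Metric.diam (M.cell T) * Metric.diam (M.cell T) :=
          mul_le_mul_of_nonneg_left h1 (ht0 hT).le
      _ = r := div_mul_cancel₀ _ (hD hT).ne'
  have hf3 : ∀ {T}, T ∈ s → (r / σ) ^ d ≤ volume.real (f T) := by
    intro T hT
    have h1 : volume.real (f T)
        = (r / Metric.diam (M.cell T)) ^ d * volume.real (M.cell T) := by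
      rw [measureReal_def, Measure.addHaar_image_homothety, volume_interior_cell,
        ENNReal.toReal_mul, ENNReal.toReal_ofReal (abs_nonneg _), finrank_euclideanSpace_fin,
        abs_of_pos (pow_pos (ht0 hT) d), measureReal_def]
    rw [h1]
    have h2 := mul_le_mul_of_nonneg_left (h.le_volume_cell hd hσ (hs1 hT))
      (pow_nonneg (ht0 hT).le d)
    refine le_of_eq_of_le ?_ h2
    rw [← mul_pow]
    congr 1
    have := (hD hT).ne'
    field_simp
  have hfin : ∀ T ∈ s, volume (f T) ≠ ⊤ := fun T hT =>
    ((measure_mono (hf2 hT)).trans_lt measure_closedBall_lt_top).ne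
  have hopen : ∀ T ∈ s, MeasurableSet (f T) := fun T hT =>
    (AffineMap.homothety_isOpenMap _ _ (ht0 hT).ne' _ isOpen_interior).measurableSet
  have hdisj : (s : Set (Finset (Fin n))).PairwiseDisjoint f := fun T hT T' hT' hne =>
    (M.disjoint_interior_cell (hs1 hT) (hs1 hT') hne).mono (hf1 hT) (hf1 hT')
  have h1 : (s.card : ℝ) * (r / σ) ^ d ≤ r ^ d *
      volume.real (Metric.closedBall (0 : EuclideanSpace ℝ (Fin d)) 1) := by
    calc (s.card : ℝ) * (r / σ) ^ d ≤ ∑ T ∈ s, volume.real (f T) := by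
          rw [← nsmul_eq_mul]
          exact Finset.card_nsmul_le_sum _ _ _ fun T hT => hf3 hT
      _ = volume.real (⋃ T ∈ s, f T) := (measureReal_biUnion_finset hdisj hopen hfin).symm
      _ ≤ volume.real (Metric.closedBall (M.node i) r) :=
          measureReal_mono (Set.iUnion₂_subset fun T hT => hf2 hT) measure_closedBall_lt_top.ne
      _ = _ := by
          rw [measureReal_def, Measure.addHaar_closedBall' _ _ hr0.le, ENNReal.toReal_mul,
            ENNReal.toReal_ofReal (by positivity), finrank_euclideanSpace_fin, measureReal_def]
  rw [div_pow, mul_div_assoc', div_le_iff₀ (by positivity)] at h1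
  refine le_of_mul_le_mul_left ?_ (pow_pos hr0 d)
  linarith

end SimplicialMesh

end JumpAMG

namespace JumpAMG

open MeasureTheory

/-! ### The assembled stiffness matrix -/

namespace SimplicialMesh

variable {d n : ℕ} {M : SimplicialMesh d n} {A : Matrix (Fin n) (Fin n) ℝ}
  {μ : Finset (Fin n) → ℝ}

/-- The form of `hA` hides the integrals: μ_T will be coefficient times volume, and the energy
becomes a weighted sum of squared element gradients. -/
lemma normSq_assembled
    (hA : ∀ i j, A i j = ∑ T ∈ M.elems, μ T * ⟪M.localGrad T j, M.localGrad T i⟫_ℝ)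
    (v : Fin n → ℝ) :
    normSq A v = ∑ T ∈ M.elems, μ T * ‖∑ k, v k • M.localGrad T k‖ ^ 2 := by
  have h1 : ∀ T, ‖∑ k, v k • M.localGrad T k‖ ^ 2
      = ∑ i, ∑ j, v i * v j * ⟪M.localGrad T j, M.localGrad T i⟫_ℝ := fun T => by
    rw [← real_inner_self_eq_norm_sq, inner_sum]
    refine Finset.sum_congr rfl fun i _ => ?_
    rw [sum_inner]
    refine Finset.sum_congr rfl fun j _ => ?_
    rw [real_inner_smul_left, real_inner_smul_right]
    ring
  simp only [normSq, dotProduct, Matrix.mulVec, hA, h1, Finset.mul_sum, Finset.sum_mul]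
  conv_rhs => rw [Finset.sum_comm]
  refine Finset.sum_congr rfl fun i _ => ?_
  rw [Finset.sum_comm]
  refine Finset.sum_congr rfl fun T _ => Finset.sum_congr rfl fun j _ => ?_
  ring

lemma isSymm_assembled
    (hA : ∀ i j, A i j = ∑ T ∈ M.elems, μ T * ⟪M.localGrad T j, M.localGrad T i⟫_ℝ) :
    A.IsSymm := by
  ext i j
  rw [Matrix.transpose_apply, hA, hA]
  exact Finset.sum_congr rfl fun T _ => by rw [real_inner_comm]

lemma sum_row_assembled
    (hA : ∀ i j, A i j = ∑ T ∈ M.elems, μ T * ⟪M.localGrad T j, M.localGrad T i⟫_ℝ)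
    (i : Fin n) : ∑ j, A i j = 0 := by
  simp only [hA]
  rw [Finset.sum_comm]
  refine Finset.sum_eq_zero fun T hT => ?_
  rw [← Finset.mul_sum, ← sum_inner, M.sum_localGrad hT, inner_zero_left, mul_zero]

lemma diag_assembled_pos (hd : 1 ≤ d) (hμ : ∀ T ∈ M.elems, 0 < μ T)
    (hA : ∀ i j, A i j = ∑ T ∈ M.elems, μ T * ⟪M.localGrad T j, M.localGrad T i⟫_ℝ)
    (i : Fin n) : 0 < A i i := by
  obtain ⟨T, hT, hi⟩ := M.node_mem i
  rw [hA]
  refine Finset.sum_pos' (fun T hT => mul_nonneg (hμ T hT).le real_inner_self_nonneg)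
    ⟨T, hT, mul_pos (hμ T hT) (real_inner_self_pos.2 (M.localGrad_ne_zero hd hT hi))⟩

/-- Rows of the stiffness matrix of a shape regular mesh have boundedly many nonzero entries. -/
lemma card_row_assembled_le (hd : 1 ≤ d) {σ : ℝ} (hσ : 0 < σ) (hM : M.IsShapeRegular σ)
    (hA : ∀ i j, A i j = ∑ T ∈ M.elems, μ T * ⟪M.localGrad T j, M.localGrad T i⟫_ℝ)
    (i : Fin n) : (Finset.univ.filter fun k => k ≠ i ∧ A i k ≠ 0).card ≤
      ⌈σ ^ d * volume.real (Metric.closedBall (0 : EuclideanSpace ℝ (Fin d)) 1)⌉₊ * (d + 1) := by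
  have hsub : (Finset.univ.filter fun k => k ≠ i ∧ A i k ≠ 0) ⊆
      (M.elems.filter fun T => i ∈ T).biUnion id := by
    intro k hk
    have h1 := (Finset.mem_filter.1 hk).2.2
    rw [hA] at h1
    obtain ⟨T, hT, h2⟩ := Finset.exists_ne_zero_of_sum_ne_zero h1
    have hi : i ∈ T := by
      by_contra h
      exact h2 (by rw [M.localGrad_of_notMem h, inner_zero_right, mul_zero])
    have hk : k ∈ T := by
      by_contra h
      exact h2 (by rw [M.localGrad_of_notMem h, inner_zero_left, mul_zero])
    exact Finset.mem_biUnion.2 ⟨T, Finset.mem_filter.2 ⟨hT, hi⟩, hk⟩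
  refine (Finset.card_le_card hsub).trans ((Finset.card_biUnion_le_card_mul _ _ (d + 1)
    fun T hT => (M.card_elem T (Finset.mem_filter.1 hT).1).le).trans ?_)
  refine Nat.mul_le_mul_right _ ?_
  exact_mod_cast (hM.card_elems_around_le hd hσ i).trans (Nat.le_ceil _)

open Classical in
/-- The energy of the filtered matrix is bounded by that of the stiffness matrix. -/
lemma sum_edges_assembled_le {σ : ℝ} (hσ : 0 ≤ σ) (hM : M.IsShapeRegular σ)
    (hμ : ∀ T ∈ M.elems, 0 ≤ μ T)
    (hA : ∀ i j, A i j = ∑ T ∈ M.elems, μ T * ⟪M.localGrad T j, M.localGrad T i⟫_ℝ)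
    (G : SimpleGraph (Fin n)) (v : Fin n → ℝ) :
    (∑ i, ∑ j, if G.Adj i j then -A i j * (v i - v j) ^ 2 else 0)
      ≤ (d + 1) ^ 2 * σ ^ 2 * normSq A v := by
  set g : Finset (Fin n) → EuclideanSpace ℝ (Fin d) :=
    fun T => ∑ k, v k • M.localGrad T k with hg
  -- Coefficient-free local bound: the two coordinate gradients absorb the two diameters from (v_i -
  -- v_j)². The inner product may have either sign, as only an upper bound is needed.
  have hlocal : ∀ T ∈ M.elems, ∀ i j, -⟪M.localGrad T j, M.localGrad T i⟫_ℝ * (v i - v j) ^ 2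
      ≤ if i ∈ T ∧ j ∈ T then σ ^ 2 * ‖g T‖ ^ 2 else 0 := by
    intro T hT i j
    by_cases h : i ∈ T ∧ j ∈ T
    · rw [if_pos h]
      set δ := Metric.diam (M.cell T)
      have h1 : -⟪M.localGrad T j, M.localGrad T i⟫_ℝ
          ≤ ‖M.localGrad T j‖ * ‖M.localGrad T i‖ :=
        (neg_le_abs _).trans (abs_real_inner_le_norm _ _)
      have h2 : (v i - v j) ^ 2 ≤ (‖g T‖ * δ) ^ 2 := by
        rw [← M.inner_sum_smul_localGrad hT h.1 h.2 v, ← sq_abs]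
        refine pow_le_pow_left₀ (abs_nonneg _) ((abs_real_inner_le_norm _ _).trans ?_) 2
        exact mul_le_mul_of_nonneg_left (M.norm_node_sub_le_diam h.1 h.2) (norm_nonneg _)
      have h3 := hM.norm_localGrad_mul_diam_le hσ hT i
      have h4 := hM.norm_localGrad_mul_diam_le hσ hT j
      have hδ : 0 ≤ δ := Metric.diam_nonneg
      calc _ ≤ ‖M.localGrad T j‖ * ‖M.localGrad T i‖ * (‖g T‖ * δ) ^ 2 :=
            mul_le_mul h1 h2 (sq_nonneg _) (by positivity)
        _ = (‖M.localGrad T j‖ * δ) * (‖M.localGrad T i‖ * δ) * ‖g T‖ ^ 2 := by ring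
        _ ≤ σ * σ * ‖g T‖ ^ 2 :=
            mul_le_mul_of_nonneg_right (mul_le_mul h4 h3 (by positivity) hσ) (sq_nonneg _)
        _ = _ := by ring
    · rw [if_neg h]
      rcases not_and_or.1 h with h | h
      · rw [M.localGrad_of_notMem h, inner_zero_right, neg_zero, zero_mul]
      · rw [M.localGrad_of_notMem h, inner_zero_left, neg_zero, zero_mul]
  -- An element has (d + 1)² ordered pairs of vertices.
  have hcount : ∀ T ∈ M.elems, ∑ i, ∑ j, (if i ∈ T ∧ j ∈ T then σ ^ 2 * ‖g T‖ ^ 2 else 0)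
      = (d + 1) ^ 2 * (σ ^ 2 * ‖g T‖ ^ 2) := by
    intro T hT
    rw [← Finset.sum_product', ← Finset.sum_filter, Finset.sum_const, nsmul_eq_mul]
    have : (Finset.univ ×ˢ Finset.univ).filter (fun x : Fin n × Fin n => x.1 ∈ T ∧ x.2 ∈ T)
        = T ×ˢ T := by
      ext x
      simp
    rw [this, Finset.card_product, M.card_elem T hT]
    push_cast
    ring
  calc _ ≤ ∑ i, ∑ j, ∑ T ∈ M.elems,
        μ T * (if i ∈ T ∧ j ∈ T then σ ^ 2 * ‖g T‖ ^ 2 else 0) := by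
        refine Finset.sum_le_sum fun i _ => Finset.sum_le_sum fun j _ => ?_
        split_ifs with h
        · rw [hA, ← Finset.sum_neg_distrib, Finset.sum_mul]
          refine Finset.sum_le_sum fun T hT => ?_
          rw [← mul_neg, mul_assoc]
          exact mul_le_mul_of_nonneg_left (hlocal T hT i j) (hμ T hT)
        · refine Finset.sum_nonneg fun T hT => mul_nonneg (hμ T hT) ?_
          split_ifs <;> positivity
    _ = ∑ T ∈ M.elems, ∑ i, ∑ j,
        μ T * (if i ∈ T ∧ j ∈ T then σ ^ 2 * ‖g T‖ ^ 2 else 0) := by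
        rw [Finset.sum_comm' (t' := Finset.univ) (s' := fun _ => M.elems) (by simp)]
        exact Finset.sum_congr rfl fun i _ => Finset.sum_comm
    _ = ∑ T ∈ M.elems, μ T * ((d + 1) ^ 2 * (σ ^ 2 * ‖g T‖ ^ 2)) := by
        refine Finset.sum_congr rfl fun T hT => ?_
        rw [← hcount T hT]
        simp only [Finset.mul_sum]
    _ = _ := by
        rw [normSq_assembled hA, Finset.mul_sum]
        exact Finset.sum_congr rfl fun T _ => by ring

end SimplicialMesh

end JumpAMG

/-! ### Choice of the constant and conclusion. -/

theorem mainTheorem1 (d : ℕ) (hd : 1 ≤ d) (hd' : d ≤ 3) (σ : ℝ) (hσ : 1 ≤ σ)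
    (θ : ℝ) (hθ : 0 < θ) (hθ' : θ < 1) :
    ∃ K : ℝ, 1 ≤ K ∧
      ∀ (n : ℕ) (M : JumpAMG.SimplicialMesh d n) (Ω Ω₁ Ω₂ : Set (EuclideanSpace ℝ (Fin d))) (ε : ℝ)
        (A : Matrix (Fin n) (Fin n) ℝ) (G : SimpleGraph (Fin n)) (C : Finset (Fin n)),
        M.IsMeshOf Ω → M.IsShapeRegular σ →
        JumpAMG.IsAlignedSplitting M Ω Ω₁ Ω₂ → 0 < ε →
        A = M.stiffness Ω (JumpAMG.jumpCoeff Ω₁ Ω₂ ε) →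
        G = JumpAMG.strongGraph A θ →
        JumpAMG.IsMIS G C →
        JumpAMG.IsAdmissible G C (JumpAMG.standardWeights (JumpAMG.filtered A G) C) ∧
        ∀ p : Matrix (Fin n) (Fin n) ℝ, JumpAMG.IsAdmissible G C p →
        ∀ (R : Matrix (Fin n) (Fin n) ℝ) (c : ℝ), JumpAMG.IsSmoother A R c →
        1 ≤ c ∧ ∀ v : Fin n → ℝ,
          JumpAMG.normSq A (JumpAMG.errorProp A R (JumpAMG.prolong G C p) v)
            ≤ (1 - 1 / (c * K)) * JumpAMG.normSq A v := by
  classical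
  have hσ0 : 0 < σ := by linarith
  set N : ℕ := ⌈σ ^ d * MeasureTheory.volume.real
    (Metric.closedBall (0 : EuclideanSpace ℝ (Fin d)) 1)⌉₊ * (d + 1)
  set K₀ : ℝ := N * (1 + N + N * N : ℕ) ^ 2 * (2 / θ ^ 2) * (1 + N)
  have hK₀0 : 0 ≤ K₀ := by positivity
  -- The product of the graph constant and the element constant; the maximum with 1 keeps the rate
  -- nonnegative.
  refine ⟨max 1 (K₀ * ((d + 1) ^ 2 * σ ^ 2)), le_max_left _ _, ?_⟩
  intro n M Ω Ω₁ Ω₂ ε A G C hΩ hM hsplit hε hAeq hG hC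
  set μ : Finset (Fin n) → ℝ := fun T => (if interior (M.cell T) ⊆ Ω₁ then ε else 1) *
    MeasureTheory.volume.real (M.cell T)
  have hμ : ∀ T ∈ M.elems, 0 < μ T := fun T hT =>
    mul_pos (by split_ifs <;> positivity) (hM.volume_cell_pos hd hσ0 hT)
  have hA : ∀ i j, A i j = ∑ T ∈ M.elems, μ T * ⟪M.localGrad T j, M.localGrad T i⟫_ℝ :=
    fun i j => by
      rw [hAeq, M.stiffness_jumpCoeff_apply hΩ hsplit]
  have hsymm := JumpAMG.SimplicialMesh.isSymm_assembled hA
  have hrow := JumpAMG.SimplicialMesh.sum_row_assembled hA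
  have hdiag := JumpAMG.SimplicialMesh.diag_assembled_pos hd hμ hA
  have hA0 : ∀ v, 0 ≤ JumpAMG.normSq A v := fun v => by
    rw [JumpAMG.SimplicialMesh.normSq_assembled hA]
    exact Finset.sum_nonneg fun T hT => mul_nonneg (hμ T hT).le (sq_nonneg _)
  -- A nonempty domain supplies a node, whose positive diagonal entry gives c ≥ 1.
  obtain ⟨T, hT⟩ := hΩ.elems_nonempty
  obtain ⟨i, -⟩ : T.Nonempty := Finset.card_pos.1 (by rw [M.card_elem T hT]; omega)
  subst hG
  refine ⟨JumpAMG.isAdmissible_standardWeights hsymm hrow hdiag hθ hC, fun p hp R c hR => ?_⟩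
  have hc : 1 ≤ c := hR.one_le hsymm hA0 (hdiag i)
  refine ⟨hc, JumpAMG.normSq_errorProp_le hsymm hA0 hR hc (le_max_left _ _) _ fun v => ?_⟩
  obtain ⟨x, hx⟩ := JumpAMG.exists_normSq_diagonal_sub_prolong_le hsymm hrow hdiag hθ hθ'
    (JumpAMG.SimplicialMesh.card_row_assembled_le hd hσ0 hM hA) hp v
  refine ⟨x, hx.trans ?_⟩
  have h1 := JumpAMG.SimplicialMesh.sum_edges_assembled_le hσ0.le hM (fun T hT => (hμ T hT).le)
    hA (JumpAMG.strongGraph A θ) v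
  calc _ ≤ K₀ * ((d + 1) ^ 2 * σ ^ 2 * JumpAMG.normSq A v) := mul_le_mul_of_nonneg_left h1 hK₀0
    _ = K₀ * ((d + 1) ^ 2 * σ ^ 2) * JumpAMG.normSq A v := by ring
    _ ≤ _ := mul_le_mul_of_nonneg_right (le_max_right _ _) (hA0 v)
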